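/- Let $\Gamma$ be a finite connected simplicial graph, let $A(\Gamma)=\langle v\in V(\Gamma)\mid [u,v]=1 \text{ for all } \{u,v\}\in E(\Gamma)\rangle$ be its right-angled Artin group, and write $x^g=g^{-1}xg$. The extension graph $\Gamma^e$ has vertex set $\{v^g : v\in V(\Gamma),\ g\in A(\Gamma)\}\subset A(\Gamma)$, two distinct vertices being adjacent when they commute in $A(\Gamma)$; $A(\Gamma)$ acts on $\Gamma^e$ on the right by $x\mapsto x^g$. Let $d$ be the edge metric on $\Gamma^e$. An element $g$ is loxodromic if its asymptotic translation length $\tau(g)=\lim_{n\to\infty} d(x,x^{g^n})/n$ is positive. An axial subgraph of $g$ is a nonempty subgraph $\mathcal A\subseteq\Gamma^e$ that is weakly convex (any two vertices of $\mathcal A$ are joined by a geodesic of $\Gamma^e$ contained in $\mathcal A$), locally finite, and $g$-invariant, and on which $\langle g\rangle$ acts cocompactly. An action on a graph has the finiteness property if every loxodromic element has an axial subgraph. A syllable is a nonzero power $v^k$ of a vertex $v\in V(\Gamma)$; the syllable length $\|g\|_{\rm syl}$ is the least $n$ such that $g$ is a product of $n$ syllables, and a syllable decomposition of $g$ is an expression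 $g=s_n\cdots s_1$ with syllables $s_i$ and $n=\|g\|_{\rm syl}$. An element $g$ is cyclically syllable-reduced if $\|g\|_{\rm syl}=\min_{h\in A(\Gamma)}\|g^h\|_{\rm syl}$. Let $\Gamma^h$ be the subgraph of $\Gamma^e$ induced on $\{v^h: v\in V(\Gamma)\}$, identify $\Gamma$ with $\Gamma^1$, and put $$\Lambda_g=\Gamma\cup\bigcup_{g=s_n\cdots s_1}\ \bigcup_{i=1}^n\Gamma^{s_i\cdots s_1},\qquad \mathcal T_g=\bigcup_{m\ge 1}\bigl(\Lambda_{g^{2m}}\bigr)^{g^{-m}},$$ where the first union runs over all syllable decompositions of $g$. The width of a graph is the least cardinality of a finite set $S$ of its vertices separating its ends (distinct ends lie in distinct components of the complement of $S$), and is $\infty$ if there is no such $S$. **Theorem.** The action of $A(\Gamma)$ on $\Gamma^e$ has the finiteness property. Concretely, for every cyclically syllable-reduced loxodromic $g\in A(\Gamma)$, the subgraph $\mathcal T_g$ is an axial subgraph of $g$, and it has finite width: there is an integer $\kappa$, which may depend on $g$, such that the width of $\mathcal T_g$ is at most $\kappa$. -/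

import Mathlib

open MulOpposite Filter Topology

/-! ### Simplicial right actions on graphs, loxodromic elements, axial subgraphs

A simplicial right action of `G` on the graph `𝒢` is a homomorphism
`ρ : Gᵐᵒᵖ →* (𝒢 ≃g 𝒢)`; the image of the vertex `x` under `g` is `ρ (op g) x`. -/

section Actions

variable {G : Type*} [Group G] {X : Type*} {𝒢 : SimpleGraph X}

/-- `τ` is the asymptotic translation length `lim d(x, x·gⁿ) / n` of `g` for the edge metric. -/
def HasTranslationLength (ρ : Gᵐᵒᵖ →* (𝒢 ≃g 𝒢)) (g : G) (τ : ℝ) : Prop :=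
  ∀ x : X, Tendsto (fun n : ℕ => (𝒢.dist x (ρ (op (g ^ n)) x) : ℝ) / (n : ℝ)) atTop (𝓝 τ)

/-- An element is loxodromic if its asymptotic translation length is positive. -/
def IsLoxodromic (ρ : Gᵐᵒᵖ →* (𝒢 ≃g 𝒢)) (g : G) : Prop :=
  ∃ τ : ℝ, 0 < τ ∧ HasTranslationLength ρ g τ

/-- The image `A·g` of a subgraph under the action of `g`. -/
def translateSubgraph (ρ : Gᵐᵒᵖ →* (𝒢 ≃g 𝒢)) (g : G) (A : 𝒢.Subgraph) : 𝒢.Subgraph :=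
  A.map (ρ (op g)).toHom

/-- Any two vertices of `A` are joined by a geodesic of `𝒢` lying in `A`. -/
def IsWeaklyConvex (A : 𝒢.Subgraph) : Prop :=
  ∀ x ∈ A.verts, ∀ y ∈ A.verts, ∃ p : 𝒢.Walk x y, p.length = 𝒢.dist x y ∧ p.toSubgraph ≤ A

/-- Every vertex of `A` has finitely many neighbours in `A`. -/
def IsLocallyFinite (A : 𝒢.Subgraph) : Prop :=
  ∀ x ∈ A.verts, (A.neighborSet x).Finite

/-- `A` is covered by the translates of a finite subgraph of `A` under the powers of `g`. -/
def IsCocompact (ρ : Gᵐᵒᵖ →* (𝒢 ≃g 𝒢)) (g : G) (A : 𝒢.Subgraph) : Prop :=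
  ∃ K : 𝒢.Subgraph, K.verts.Finite ∧ K ≤ A ∧ A ≤ ⨆ k : ℤ, translateSubgraph ρ (g ^ k) K

/-- A nonempty, weakly convex, locally finite subgraph which is preserved by `g` and on which
the cyclic group generated by `g` acts cocompactly. -/
structure IsAxialSubgraph (ρ : Gᵐᵒᵖ →* (𝒢 ≃g 𝒢)) (g : G) (A : 𝒢.Subgraph) : Prop where
  nonempty : A.verts.Nonempty
  weaklyConvex : IsWeaklyConvex A
  locallyFinite : IsLocallyFinite A
  invariant : translateSubgraph ρ g A = A
  cocompact : IsCocompact ρ g A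

/-- The finiteness property: every loxodromic element has an axial subgraph. -/
def HasFinitenessProperty (ρ : Gᵐᵒᵖ →* (𝒢 ≃g 𝒢)) : Prop :=
  ∀ g : G, IsLoxodromic ρ g → ∃ A : 𝒢.Subgraph, IsAxialSubgraph ρ g A

end Actions

/-! ### Width -/

section Width

variable {X : Type*}

/-- A finite set `S` of vertices separates the ends of the graph `H`: distinct ends of `H` lie in
distinct connected components of the complement of `S`. -/
def IsEndSeparating (H : SimpleGraph X) (S : Finset X) : Prop :=
  ∀ e₁ ∈ H.end, ∀ e₂ ∈ H.end, e₁ ≠ e₂ → e₁ (Opposite.op S) ≠ e₂ (Opposite.op S)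

/-- The minimal cardinality of an end-separating set (`⊤` if there is no finite one). -/
noncomputable def graphWidth (H : SimpleGraph X) : ℕ∞ :=
  ⨅ (S : Finset X) (_ : IsEndSeparating H S), (S.card : ℕ∞)

end Width

/-! ### Right-angled Artin groups -/

section RAAG

variable {V : Type*}

/-- The commutators of adjacent vertices. -/
def raagRels (Γ : SimpleGraph V) : Set (FreeGroup V) :=
  {r | ∃ u v : V, Γ.Adj u v ∧
    r = FreeGroup.of u * FreeGroup.of v * (FreeGroup.of u)⁻¹ * (FreeGroup.of v)⁻¹}

/-- The right-angled Artin group `A(Γ)`. -/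
abbrev RAAG (Γ : SimpleGraph V) : Type _ := PresentedGroup (raagRels Γ)

/-- The generator of `A(Γ)` given by a vertex of `Γ`. -/
def RAAG.gen (Γ : SimpleGraph V) (v : V) : RAAG Γ := PresentedGroup.of v

/-- A syllable is a nonzero power of a vertex. -/
def IsSyllable (Γ : SimpleGraph V) (s : RAAG Γ) : Prop :=
  ∃ (v : V) (k : ℤ), k ≠ 0 ∧ s = RAAG.gen Γ v ^ k

/-- The smallest number of syllables whose product is `g`. -/
noncomputable def sylLength (Γ : SimpleGraph V) (g : RAAG Γ) : ℕ :=
  sInf {n | ∃ l : List (RAAG Γ), (∀ s ∈ l, IsSyllable Γ s) ∧ l.prod = g ∧ l.length = n}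

/-- The list `[sₙ, …, s₁]` of syllables is a syllable decomposition `g = sₙ ⋯ s₁`. -/
def IsSyllableDecomposition (Γ : SimpleGraph V) (l : List (RAAG Γ)) (g : RAAG Γ) : Prop :=
  (∀ s ∈ l, IsSyllable Γ s) ∧ l.prod = g ∧ l.length = sylLength Γ g

/-- `g` has the smallest syllable length in its conjugacy class. -/
def IsCyclicallySyllableReduced (Γ : SimpleGraph V) (g : RAAG Γ) : Prop :=
  ∀ h : RAAG Γ, sylLength Γ g ≤ sylLength Γ (h⁻¹ * g * h)

/-! ### The extension graph -/

/-- The vertices of the extension graph: the conjugates `v^g = g⁻¹ v g` of the vertices of `Γ`. -/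
def ExtVertex (Γ : SimpleGraph V) : Type _ :=
  {x : RAAG Γ // ∃ (v : V) (g : RAAG Γ), x = g⁻¹ * RAAG.gen Γ v * g}

/-- The vertex `v^g` of the extension graph. -/
def ExtVertex.mk (Γ : SimpleGraph V) (v : V) (g : RAAG Γ) : ExtVertex Γ :=
  ⟨g⁻¹ * RAAG.gen Γ v * g, v, g, rfl⟩

/-- The extension graph `Γᵉ`: distinct vertices are adjacent when they commute in `A(Γ)`. -/
def extensionGraph (Γ : SimpleGraph V) : SimpleGraph (ExtVertex Γ) where
  Adj x y := x ≠ y ∧ Commute x.1 y.1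
  symm := ⟨fun _ _ h => ⟨h.1.symm, h.2.symm⟩⟩
  loopless := ⟨fun _ h => h.1 rfl⟩

/-- `x ↦ x^g = g⁻¹ x g` on the vertices of the extension graph. -/
def ExtVertex.conj (Γ : SimpleGraph V) (g : RAAG Γ) (x : ExtVertex Γ) : ExtVertex Γ :=
  ⟨g⁻¹ * x.1 * g, by
    obtain ⟨x, v, h, rfl⟩ := x
    exact ⟨v, h * g, by simp only [mul_inv_rev, mul_assoc]⟩⟩

theorem ExtVertex.conj_conj (Γ : SimpleGraph V) (g h : RAAG Γ) (x : ExtVertex Γ) :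
    ExtVertex.conj Γ h (ExtVertex.conj Γ g x) = ExtVertex.conj Γ (g * h) x := by
  apply Subtype.ext
  simp only [ExtVertex.conj, mul_inv_rev, mul_assoc]

theorem ExtVertex.conj_one (Γ : SimpleGraph V) (x : ExtVertex Γ) :
    ExtVertex.conj Γ 1 x = x := by
  apply Subtype.ext
  simp only [ExtVertex.conj, inv_one, one_mul, mul_one]

theorem ExtVertex.commute_conj (Γ : SimpleGraph V) (g : RAAG Γ) (x y : ExtVertex Γ) :
    Commute (ExtVertex.conj Γ g x).1 (ExtVertex.conj Γ g y).1 ↔ Commute x.1 y.1 := by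
  have := Commute.conj_iff (a := x.1) (b := y.1) g⁻¹
  simpa only [ExtVertex.conj, inv_inv] using this

/-- Conjugation by `g` as an automorphism of the extension graph. -/
def ExtVertex.conjIso (Γ : SimpleGraph V) (g : RAAG Γ) :
    extensionGraph Γ ≃g extensionGraph Γ where
  toFun := ExtVertex.conj Γ g
  invFun := ExtVertex.conj Γ g⁻¹
  left_inv x := by rw [ExtVertex.conj_conj, mul_inv_cancel, ExtVertex.conj_one]
  right_inv x := by rw [ExtVertex.conj_conj, inv_mul_cancel, ExtVertex.conj_one]
  map_rel_iff' := by
    intro x y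
    have hinj : Function.Injective (ExtVertex.conj Γ g) :=
      Function.LeftInverse.injective (g := ExtVertex.conj Γ g⁻¹) (fun x => by
        rw [ExtVertex.conj_conj, mul_inv_cancel, ExtVertex.conj_one])
    exact and_congr hinj.ne_iff (ExtVertex.commute_conj Γ g x y)

/-- The right action of `A(Γ)` on the extension graph by conjugation. -/
def extAction (Γ : SimpleGraph V) :
    (RAAG Γ)ᵐᵒᵖ →* (extensionGraph Γ ≃g extensionGraph Γ) where
  toFun g := ExtVertex.conjIso Γ (unop g)
  map_one' := RelIso.ext fun x => ExtVertex.conj_one Γ x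
  map_mul' g h := RelIso.ext fun x => (ExtVertex.conj_conj Γ (unop h) (unop g) x).symm

/-- The subgraph `Γ^g` of the extension graph, induced on the vertices `v^g`. -/
def gammaTranslate (Γ : SimpleGraph V) (g : RAAG Γ) : (extensionGraph Γ).Subgraph :=
  (⊤ : (extensionGraph Γ).Subgraph).induce (Set.range fun v => ExtVertex.mk Γ v g)

/-- The union of `Γ` and of all `Γ^{sᵢ ⋯ s₁}`, where `g = sₙ ⋯ s₁` runs over the syllable
decompositions of `g` and `1 ≤ i ≤ n`. The products `sᵢ ⋯ s₁` are those of the nonempty suffixes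
of the list `[sₙ, …, s₁]`. -/
def lambdaSubgraph (Γ : SimpleGraph V) (g : RAAG Γ) : (extensionGraph Γ).Subgraph :=
  gammaTranslate Γ 1 ⊔
    ⨆ (l : List (RAAG Γ)) (_ : IsSyllableDecomposition Γ l g)
      (t : List (RAAG Γ)) (_ : t <:+ l ∧ t ≠ []), gammaTranslate Γ t.prod

/-- `𝒯_g`: the union over `m ≥ 1` of the translates by `g⁻ᵐ` of the subgraphs
`lambdaSubgraph Γ (g ^ (2 * m))`. -/
def axialT (Γ : SimpleGraph V) (g : RAAG Γ) : (extensionGraph Γ).Subgraph :=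
  ⨆ (m : ℕ) (_ : 1 ≤ m),
    translateSubgraph (extAction Γ) ((g ^ m)⁻¹) (lambdaSubgraph Γ (g ^ (2 * m)))

end RAAG

/-! ### Elementary facts about right-angled Artin groups -/

/-! View the elements of A(Γ) as chambers. Left multiplication of h by a power of v crosses the wall
v^h, which is a vertex of Γᵉ, and `coord g x` is the total exponent with which x is crossed on the
way from 1 to g. It is well defined because commuting vertices do not move each other's walls. Only
finitely many coordinates are nonzero, their number is the syllable length
(`sylLength_eq_ncard_walls`), and they determine g (`coord_injective`). Two facts about walls drive
everything: commuting walls lie in one translate of Γ (`exists_common_chamber`), and non-commuting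
walls are nested (`exists_nested`).

Let `interval g` consist of the h whose coordinates are each 0 or that of g; these are the suffix
products of syllable decompositions, so Λ_g is the union of Γ^h over the interval. Every h has a
largest common initial part `meet g h` with g, and v^h ↦ v^(meet g h) is a well-defined simplicial
retraction of Γᵉ onto Λ_g. It sends geodesics between points of Λ_g to geodesics inside Λ_g, whence
weak convexity (`isWeaklyConvex_interval`). The graph 𝒯_g is an increasing union of translates of
such graphs, so it is weakly convex too.

If g is cyclically syllable-reduced and loxodromic, repeating a reduced word of g never crosses a
wall twice (`exists_isAxis`): a first repetition would make g fix a vertex. The walls of powers of g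
thus form a sequence, and an element of an interval of g^m crosses a subset of it closed downwards
for the order generated by non-commuting types. The types occurring in g do not split into two
commuting families, as otherwise orbits would be bounded (`not_split`). Hence the crossed set is an
initial segment up to bounded error, and intervals of all powers of g lie in one finite interval up
to powers of g (`exists_bound`). This gives cocompactness, and local finiteness because powers of g
act freely on vertices.

Finite width holds for any axial subgraph of a loxodromic element: outside a finite set it has at
most two components that carry ends. The finiteness property follows by conjugating to a cyclically
syllable-reduced element. -/

section Basic

variable {V : Type*} {Γ : SimpleGraph V}

namespace RAAG

/-- The homomorphism out of `A(Γ)` with prescribed values on the vertices. -/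
def lift {H : Type*} [Group H] (f : V → H) (hf : ∀ u v, Γ.Adj u v → Commute (f u) (f v)) :
    RAAG Γ →* H :=
  PresentedGroup.toGroup (f := f) (by
    rintro r ⟨u, v, huv, rfl⟩
    have h : f u * f v = f v * f u := hf u v huv
    simp [h])

@[simp]
theorem lift_gen {H : Type*} [Group H] (f : V → H)
    (hf : ∀ u v, Γ.Adj u v → Commute (f u) (f v)) (v : V) : lift f hf (gen Γ v) = f v :=
  PresentedGroup.toGroup.of _

theorem commute_gen {u v : V} (h : Γ.Adj u v) : Commute (gen Γ u) (gen Γ v) := by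
  have h1 : PresentedGroup.mk (raagRels Γ) (FreeGroup.of u * FreeGroup.of v *
      (FreeGroup.of u)⁻¹ * (FreeGroup.of v)⁻¹) = 1 :=
    PresentedGroup.one_of_mem ⟨u, v, h, rfl⟩
  simp only [map_mul, map_inv] at h1
  rw [mul_inv_eq_one, mul_inv_eq_iff_eq_mul] at h1
  exact h1

theorem induction_left {P : RAAG Γ → Prop} (one : P 1)
    (mul : ∀ v h, P h → P (gen Γ v * h)) (inv : ∀ v h, P h → P ((gen Γ v)⁻¹ * h)) (g : RAAG Γ) :
    P g := by
  have hg : g ∈ Subgroup.closure (Set.range (PresentedGroup.of : V → RAAG Γ)) := by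
    rw [PresentedGroup.closure_range_of]; trivial
  induction hg using Subgroup.closure_induction_left with
  | one => exact one
  | mul_left x hx y _ ih => obtain ⟨v, rfl⟩ := hx; exact mul v y ih
  | inv_mul_cancel x hx y _ ih => obtain ⟨v, rfl⟩ := hx; exact inv v y ih

theorem induction_zpow {P : RAAG Γ → Prop} (one : P 1)
    (mul : ∀ v (k : ℤ) h, P h → P (gen Γ v ^ k * h)) (g : RAAG Γ) : P g :=
  induction_left one (fun v h hh => by simpa using mul v 1 h hh)
    (fun v h hh => by simpa using mul v (-1) h hh) g

theorem const_of_step {P : RAAG Γ → Prop} (step : ∀ v h, P h ↔ P (gen Γ v * h)) (g h : RAAG Γ) :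
    P g ↔ P h := by
  have key : ∀ g, P 1 ↔ P g := by
    intro g
    induction g using induction_left with
    | one => exact Iff.rfl
    | mul v h ih => exact ih.trans (step v h)
    | inv v h ih => rw [ih, step v ((gen Γ v)⁻¹ * h), mul_inv_cancel_left]
  exact (key g).symm.trans (key h)

open Classical in
/-- The exponent sum of the vertex `v`. -/
noncomputable def exponent (Γ : SimpleGraph V) (v : V) : RAAG Γ →* Multiplicative ℤ :=
  lift (fun w => Multiplicative.ofAdd (if w = v then 1 else 0)) (fun _ _ _ => Commute.all _ _)

theorem eq_of_isConj {u v : V} {g h : RAAG Γ}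
    (H : g⁻¹ * gen Γ u * g = h⁻¹ * gen Γ v * h) : u = v := by
  have := congrArg (exponent Γ u) H
  simp only [map_mul, map_inv, exponent, lift_gen] at this
  rw [mul_right_comm, inv_mul_cancel, mul_right_comm, inv_mul_cancel] at this
  by_contra hne
  simp [Ne.symm hne] at this

theorem gen_ne_one (v : V) : gen Γ v ≠ 1 := by
  intro H
  have := congrArg (exponent Γ v) H
  simp [exponent] at this

end RAAG

namespace ExtVertex

open RAAG

theorem exists_mk (x : ExtVertex Γ) : ∃ v g, x = mk Γ v g := by
  obtain ⟨x, v, g, rfl⟩ := x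
  exact ⟨v, g, rfl⟩

@[simp]
theorem conj_mk (g h : RAAG Γ) (v : V) : conj Γ g (mk Γ v h) = mk Γ v (h * g) := by
  apply Subtype.ext
  simp only [conj, mk, mul_inv_rev, mul_assoc]

theorem conj_injective (g : RAAG Γ) : Function.Injective (conj Γ g) :=
  (conjIso Γ g).injective

theorem conj_eq_iff {g : RAAG Γ} {x y : ExtVertex Γ} : conj Γ g x = y ↔ x = conj Γ g⁻¹ y := by
  constructor
  · rintro rfl; rw [conj_conj, mul_inv_cancel, conj_one]
  · rintro rfl; rw [conj_conj, inv_mul_cancel, conj_one]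

theorem mk_inj_left {u v : V} {g h : RAAG Γ} (H : mk Γ u g = mk Γ v h) : u = v :=
  eq_of_isConj (congrArg Subtype.val H)

theorem mk_mul (v : V) (g h : RAAG Γ) : mk Γ v (g * h) = conj Γ h (mk Γ v g) := by simp

theorem mk_one_val (v : V) : (mk Γ v 1).1 = gen Γ v := by
  simp [mk]

theorem mk_val (v : V) (g : RAAG Γ) : (mk Γ v g).1 = g⁻¹ * gen Γ v * g := rfl

theorem val_inj {x y : ExtVertex Γ} : x.1 = y.1 ↔ x = y :=
  Subtype.ext_iff.symm

theorem mk_eq_mk_one_iff {v : V} {h : RAAG Γ} : mk Γ v h = mk Γ v 1 ↔ Commute h (gen Γ v) := by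
  rw [← val_inj]
  simp only [mk, inv_one, one_mul, mul_one]
  rw [mul_assoc, inv_mul_eq_iff_eq_mul]
  exact eq_comm

theorem mk_eq_mk_iff {v : V} {g h : RAAG Γ} :
    mk Γ v g = mk Γ v h ↔ Commute (g * h⁻¹) (gen Γ v) := by
  rw [← mk_eq_mk_one_iff, mk_mul, conj_eq_iff, inv_inv, conj_mk, one_mul]

@[simp]
theorem mk_mul_of_commute {v : V} {t : RAAG Γ} (ht : Commute t (gen Γ v)) (h : RAAG Γ) :
    mk Γ v (t * h) = mk Γ v h := by
  rw [mk_eq_mk_iff, mul_inv_cancel_right]; exact ht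

theorem mk_zpow_mul (v : V) (k : ℤ) (h : RAAG Γ) : mk Γ v (gen Γ v ^ k * h) = mk Γ v h :=
  mk_mul_of_commute ((Commute.refl _).zpow_left k) h

theorem commute_mk_mk {u v : V} {h : RAAG Γ} :
    Commute (mk Γ u h).1 (mk Γ v h).1 ↔ Commute (gen Γ u) (gen Γ v) := by
  have := commute_conj Γ h (mk Γ u 1) (mk Γ v 1)
  rw [conj_mk, conj_mk, one_mul] at this
  simpa [mk] using this

end ExtVertex

/-! ### Wall coordinates -/

namespace RAAG

open ExtVertex

open Classical in
/-- The move of the generator `v` on pairs of a group element and a coordinate vector. -/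
noncomputable def coordStep (Γ : SimpleGraph V) (v : V) :
    Equiv.Perm (RAAG Γ × (ExtVertex Γ → ℤ)) where
  toFun p := (gen Γ v * p.1, fun x => p.2 x + if mk Γ v p.1 = x then 1 else 0)
  invFun p := ((gen Γ v)⁻¹ * p.1, fun x => p.2 x - if mk Γ v p.1 = x then 1 else 0)
  left_inv p := by
    ext
    · simp
    · simp [mk_mul_of_commute (Commute.refl (gen Γ v))]
  right_inv p := by
    ext
    · simp
    · simp [mk_mul_of_commute (Commute.refl (gen Γ v)).inv_left]

/-- This is what makes the coordinates well defined on the group: multiplying by u first leaves the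
wall v^p unchanged, since u commutes with v. -/
theorem coordStep_commute {u v : V} (h : Γ.Adj u v) :
    Commute (coordStep Γ u) (coordStep Γ v) := by
  have huv := commute_gen h
  refine Equiv.ext fun p => Prod.ext ?_ ?_
  · change gen Γ u * (gen Γ v * p.1) = gen Γ v * (gen Γ u * p.1)
    rw [← mul_assoc, huv.eq, mul_assoc]
  · funext x
    simp only [Equiv.Perm.mul_apply, coordStep, Equiv.coe_fn_mk]
    rw [mk_mul_of_commute huv, mk_mul_of_commute huv.symm]
    ring

/-- The coordinates of an element of `A(Γ)`: the wall of type `v` crossed between `h` and `v * h`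
is `v^h`, and crossing it raises this coordinate by one. -/
noncomputable def coord (g : RAAG Γ) : ExtVertex Γ → ℤ :=
  (lift (coordStep Γ) (fun _ _ => coordStep_commute) g (1, 0)).2

theorem lift_coordStep_apply (g : RAAG Γ) :
    lift (coordStep Γ) (fun _ _ => coordStep_commute) g (1, 0) = (g, coord g) := by
  refine Prod.ext ?_ rfl
  induction g using induction_left with
  | one => simp
  | mul v h ih =>
    rw [map_mul, Equiv.Perm.mul_apply, lift_gen]
    simp [coordStep, ih]
  | inv v h ih =>
    rw [map_mul, Equiv.Perm.mul_apply, map_inv, lift_gen, Equiv.Perm.inv_def]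
    simp [coordStep, ih]

@[simp]
theorem coord_one (x : ExtVertex Γ) : coord (1 : RAAG Γ) x = 0 := by
  simp [coord]

open Classical in
theorem coord_gen_mul (v : V) (h : RAAG Γ) (x : ExtVertex Γ) :
    coord (gen Γ v * h) x = coord h x + if mk Γ v h = x then 1 else 0 := by
  have := lift_coordStep_apply (gen Γ v * h)
  rw [map_mul, Equiv.Perm.mul_apply, lift_coordStep_apply, lift_gen] at this
  exact (congrFun (congrArg Prod.snd this) x).symm

open Classical in
theorem coord_inv_gen_mul (v : V) (h : RAAG Γ) (x : ExtVertex Γ) :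
    coord ((gen Γ v)⁻¹ * h) x = coord h x - if mk Γ v h = x then 1 else 0 := by
  have := coord_gen_mul v ((gen Γ v)⁻¹ * h) x
  rw [mul_inv_cancel_left, mk_mul_of_commute (Commute.refl (gen Γ v)).inv_left] at this
  omega

/-- The cocycle identity. -/
theorem coord_mul (g h : RAAG Γ) (x : ExtVertex Γ) :
    coord (g * h) x = coord h x + coord g (conj Γ h⁻¹ x) := by
  induction g using induction_left with
  | one => simp
  | mul v g ih =>
    rw [mul_assoc, coord_gen_mul, coord_gen_mul, ih, mk_mul, conj_eq_iff, add_assoc]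
  | inv v g ih =>
    rw [mul_assoc, coord_inv_gen_mul, coord_inv_gen_mul, ih, mk_mul, conj_eq_iff]
    ring

open Classical in
theorem coord_zpow_mul (v : V) (k : ℤ) (h : RAAG Γ) (x : ExtVertex Γ) :
    coord (gen Γ v ^ k * h) x = coord h x + if mk Γ v h = x then k else 0 := by
  induction k using Int.induction_on with
  | zero => simp
  | succ n ih =>
    rw [add_comm (n : ℤ), zpow_add, zpow_one, mul_assoc, coord_gen_mul, ih, mk_zpow_mul]
    split_ifs <;> ring
  | pred n ih =>
    rw [sub_eq_add_neg, add_comm (-(n : ℤ)), zpow_add, zpow_neg_one, mul_assoc,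
      coord_inv_gen_mul, ih, mk_zpow_mul]
    split_ifs <;> ring

theorem coord_zpow_mul_self (v : V) (k : ℤ) (h : RAAG Γ) :
    coord (gen Γ v ^ k * h) (mk Γ v h) = coord h (mk Γ v h) + k := by
  rw [coord_zpow_mul, if_pos rfl]

theorem coord_zpow_mul_of_ne {v : V} {h : RAAG Γ} {x : ExtVertex Γ} (hx : mk Γ v h ≠ x) (k : ℤ) :
    coord (gen Γ v ^ k * h) x = coord h x := by
  rw [coord_zpow_mul, if_neg hx, add_zero]

/-- The walls separating `1` from `g`. -/
def walls (g : RAAG Γ) : Set (ExtVertex Γ) := {x | coord g x ≠ 0}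

theorem mem_walls {g : RAAG Γ} {x : ExtVertex Γ} : x ∈ walls g ↔ coord g x ≠ 0 := Iff.rfl

theorem walls_zpow_mul_subset (v : V) (k : ℤ) (h : RAAG Γ) :
    walls (gen Γ v ^ k * h) ⊆ insert (mk Γ v h) (walls h) := by
  intro x hx
  by_cases hvx : mk Γ v h = x
  · exact Or.inl hvx.symm
  · rw [mem_walls, coord_zpow_mul_of_ne hvx] at hx
    exact Or.inr hx

theorem walls_finite (g : RAAG Γ) : (walls g).Finite := by
  induction g using induction_zpow with
  | one => simp [walls]
  | mul v k h ih => exact (ih.insert _).subset (walls_zpow_mul_subset v k h)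

theorem walls_zpow_mul {v : V} {k : ℤ} (hk : k ≠ 0) {h : RAAG Γ} (hx : mk Γ v h ∉ walls h) :
    walls (gen Γ v ^ k * h) = insert (mk Γ v h) (walls h) := by
  refine (walls_zpow_mul_subset v k h).antisymm ?_
  rintro x (rfl | hxh)
  · rw [mem_walls, coord_zpow_mul_self]
    rw [mem_walls, not_not] at hx
    omega
  · have : mk Γ v h ≠ x := by rintro rfl; exact hx hxh
    rwa [mem_walls, coord_zpow_mul_of_ne this]

/-! ### Syllable length -/

theorem ncard_walls_le_length (l : List (RAAG Γ)) (hl : ∀ s ∈ l, IsSyllable Γ s) :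
    (walls l.prod).ncard ≤ l.length := by
  induction l with
  | nil => simp [walls]
  | cons s l ih =>
    obtain ⟨v, k, -, rfl⟩ := hl s (by simp)
    rw [List.prod_cons, List.length_cons]
    calc _ ≤ (insert (mk Γ v l.prod) (walls l.prod)).ncard :=
          Set.ncard_le_ncard (walls_zpow_mul_subset v k _) ((walls_finite _).insert _)
      _ ≤ (walls l.prod).ncard + 1 := Set.ncard_insert_le _ _
      _ ≤ _ := Nat.succ_le_succ (ih fun s hs => hl s (by simp [hs]))

theorem exists_split_of_mem_walls (l : List (RAAG Γ)) (hl : ∀ s ∈ l, IsSyllable Γ s)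
    {x : ExtVertex Γ} (hx : x ∈ walls l.prod) :
    ∃ (a b : List (RAAG Γ)) (u : V) (j : ℤ), l = a ++ (gen Γ u ^ j) :: b ∧ mk Γ u b.prod = x := by
  induction l with
  | nil => simp [walls] at hx
  | cons s l ih =>
    obtain ⟨v, k, -, rfl⟩ := hl s (by simp)
    rw [List.prod_cons] at hx
    rcases walls_zpow_mul_subset v k _ hx with rfl | hx
    · exact ⟨[], l, v, k, rfl, rfl⟩
    · obtain ⟨a, b, u, j, rfl, hb⟩ := ih (fun s hs => hl s (by simp [hs])) hx
      exact ⟨_ :: a, b, u, j, rfl, hb⟩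

/-- A syllable whose wall has been crossed before can be merged. -/
theorem exists_merge (l : List (RAAG Γ)) (hl : ∀ s ∈ l, IsSyllable Γ s) {v : V}
    (hx : mk Γ v l.prod ∈ walls l.prod) (k : ℤ) :
    ∃ l' : List (RAAG Γ), (∀ s ∈ l', IsSyllable Γ s) ∧ l'.prod = gen Γ v ^ k * l.prod ∧
      l'.length ≤ l.length := by
  obtain ⟨a, b, u, j, rfl, hb⟩ := exists_split_of_mem_walls l hl hx
  obtain rfl := mk_inj_left hb
  rw [List.prod_append, List.prod_cons, ← mul_assoc, eq_comm, mk_eq_mk_iff,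
    mul_inv_cancel_right] at hb
  have hcomm : Commute (gen Γ u ^ k) a.prod := by
    have : Commute (a.prod * gen Γ u ^ j * (gen Γ u ^ j)⁻¹) (gen Γ u) :=
      hb.mul_left ((Commute.refl _).zpow_left j).inv_left
    rw [mul_inv_cancel_right] at this
    exact (this.zpow_right k).symm
  have hprod : a.prod * (gen Γ u ^ (k + j) * b.prod) =
      gen Γ u ^ k * (a ++ gen Γ u ^ j :: b).prod := by
    rw [List.prod_append, List.prod_cons, ← mul_assoc (gen Γ u ^ k), hcomm.eq, zpow_add]
    simp only [mul_assoc]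
  by_cases hkj : k + j = 0
  · refine ⟨a ++ b, fun s hs => hl s ?_, ?_, ?_⟩
    · simp only [List.mem_append, List.mem_cons] at hs ⊢; tauto
    · rw [← hprod, hkj]; simp
    · simp
  · refine ⟨a ++ gen Γ u ^ (k + j) :: b, fun s hs => ?_, ?_, ?_⟩
    · simp only [List.mem_append, List.mem_cons] at hs
      rcases hs with hs | rfl | hs
      · exact hl s (by simp [hs])
      · exact ⟨u, _, hkj, rfl⟩
      · exact hl s (by simp [hs])
    · rw [← hprod]; simp
    · simp

/-- Build the word one syllable at a time: a new syllable either crosses a new wall and is kept, or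
is absorbed by `exists_merge` without lengthening the list. A merged list is not a tail of the
original one, hence the induction on a length bound. -/
theorem exists_list (g : RAAG Γ) : ∃ l : List (RAAG Γ), (∀ s ∈ l, IsSyllable Γ s) ∧ l.prod = g ∧
    l.length = (walls g).ncard := by
  have key : ∀ n (l : List (RAAG Γ)), (∀ s ∈ l, IsSyllable Γ s) → l.length ≤ n →
      ∃ l' : List (RAAG Γ), (∀ s ∈ l', IsSyllable Γ s) ∧ l'.prod = l.prod ∧
        l'.length = (walls l.prod).ncard := by
    intro n
    induction n with
    | zero =>
      intro l hl hn
      obtain rfl := List.length_eq_zero_iff.mp (Nat.le_zero.mp hn)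
      exact ⟨[], by simp [walls]⟩
    | succ n ih =>
      rintro (_ | ⟨s, l⟩) hl hn
      · exact ⟨[], by simp [walls]⟩
      obtain ⟨l', hl', hprod, hlen⟩ := ih l (fun s hs => hl s (by simp [hs])) (by simpa using hn)
      have hle : l'.length ≤ n := by
        rw [hlen]
        exact (ncard_walls_le_length l fun s hs => hl s (by simp [hs])).trans (by simpa using hn)
      obtain ⟨v, k, hk, rfl⟩ := hl s (by simp)
      rw [List.prod_cons, ← hprod]
      by_cases hx : mk Γ v l'.prod ∈ walls l'.prod
      · obtain ⟨m, hm, hmprod, hmlen⟩ := exists_merge l' hl' hx k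
        rw [← hmprod]
        exact ih m hm (hmlen.trans hle)
      · refine ⟨gen Γ v ^ k :: l', ?_, rfl, ?_⟩
        · rintro s (_ | ⟨_, hs⟩)
          · exact ⟨v, k, hk, rfl⟩
          · exact hl' s hs
        · rw [walls_zpow_mul hk hx, Set.ncard_insert_of_notMem hx (walls_finite _),
            List.length_cons, hlen, hprod]
  have hex : ∃ l : List (RAAG Γ), (∀ s ∈ l, IsSyllable Γ s) ∧ l.prod = g := by
    induction g using induction_zpow with
    | one => exact ⟨[], by simp⟩
    | mul v k h ih =>
      obtain ⟨l, hl, rfl⟩ := ih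
      by_cases hk : k = 0
      · exact ⟨l, hl, by simp [hk]⟩
      refine ⟨gen Γ v ^ k :: l, ?_, rfl⟩
      rintro s (_ | ⟨_, hs⟩)
      · exact ⟨v, k, hk, rfl⟩
      · exact hl s hs
  obtain ⟨l, hl, rfl⟩ := hex
  exact key _ l hl le_rfl

theorem sylLength_eq_ncard_walls (g : RAAG Γ) : sylLength Γ g = (walls g).ncard := by
  refine le_antisymm (Nat.sInf_le ?_) (le_csInf ?_ ?_)
  · exact exists_list g
  · exact ⟨_, exists_list g⟩
  · rintro n ⟨l, hl, rfl, rfl⟩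
    exact ncard_walls_le_length l hl

/-- Induction on syllables, each of which crosses a new wall. -/
theorem induction_reduced {P : RAAG Γ → Prop} (one : P 1)
    (mul : ∀ v (k : ℤ) h, k ≠ 0 → mk Γ v h ∉ walls h → P h → P (gen Γ v ^ k * h)) (g : RAAG Γ) :
    P g := by
  obtain ⟨l, hl, rfl, hlen⟩ := exists_list g
  induction l with
  | nil => exact one
  | cons s l ih =>
    have hl' : ∀ s ∈ l, IsSyllable Γ s := fun s hs => hl s (by simp [hs])
    obtain ⟨v, k, hk, rfl⟩ := hl s (by simp)
    rw [List.prod_cons, List.length_cons] at hlen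
    have h1 := ncard_walls_le_length l hl'
    have h2 := Set.ncard_le_ncard (walls_zpow_mul_subset v k l.prod) ((walls_finite _).insert _)
    have hx : mk Γ v l.prod ∉ walls l.prod := by
      intro hx
      rw [Set.insert_eq_of_mem hx] at h2
      omega
    rw [Set.ncard_insert_of_notMem hx (walls_finite _)] at h2
    exact mul v k _ hk hx (ih hl' (by omega))

/-- By the cocycle identity g * h⁻¹ has no walls, so it is a product of zero syllables. -/
theorem coord_injective : Function.Injective (coord : RAAG Γ → ExtVertex Γ → ℤ) := by
  intro g h hgh
  have h0 : walls (g * h⁻¹) = ∅ := by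
    refine Set.eq_empty_of_forall_notMem fun x hx => hx ?_
    have := coord_mul (g * h⁻¹) h (conj Γ h x)
    rw [inv_mul_cancel_right, conj_conj, mul_inv_cancel, conj_one, hgh] at this
    omega
  obtain ⟨l, -, hprod, hlen⟩ := exists_list (g * h⁻¹)
  rw [h0, Set.ncard_empty, List.length_eq_zero_iff] at hlen
  rw [hlen, List.prod_nil] at hprod
  exact (mul_inv_eq_one.mp hprod.symm)

/-! ### Centralizers of vertices -/

theorem coord_zpow_self (v : V) (k : ℤ) : coord (gen Γ v ^ k) (mk Γ v 1) = k := by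
  have := coord_zpow_mul_self (Γ := Γ) v k 1
  simpa using this

/-- An element of the extension graph which commutes with a power of a vertex commutes with it. -/
theorem commute_of_commute_zpow {Z : RAAG Γ} {v : V} {N : ℤ} (hN : N ≠ 0)
    (h : Commute Z (gen Γ v ^ N)) : Commute Z (gen Γ v) := by
  rw [← mk_eq_mk_one_iff]
  by_contra hne
  -- Compare the coordinate at the wall v: in Z * v^N the power contributes N, in v^N * Z it
  -- contributes nothing when v^Z ≠ v.
  have h1 := coord_mul Z (gen Γ v ^ N) (mk Γ v 1)
  rw [h.eq, coord_zpow_mul_of_ne hne, coord_zpow_self, conj_mk, one_mul, ← zpow_neg,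
    ← mul_one (gen Γ v ^ (-N)), mk_zpow_mul] at h1
  omega

/-- Conjugation by v permutes the finitely many walls of t, so some nonzero power of v commutes with
x, and then v does. -/
theorem commute_of_mem_walls {t : RAAG Γ} {v : V} (ht : Commute t (gen Γ v)) {x : ExtVertex Γ}
    (hx : x ∈ walls t) : Commute x.1 (gen Γ v) := by
  have hinv : ∀ y, y ∈ walls t → conj Γ (gen Γ v) y ∈ walls t := by
    intro y hy
    have h1 := coord_gen_mul v t (conj Γ (gen Γ v) y)
    have h2 := coord_mul t (gen Γ v) (conj Γ (gen Γ v) y)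
    have h3 := coord_gen_mul v 1 (conj Γ (gen Γ v) y)
    rw [conj_conj, mul_inv_cancel, conj_one] at h2
    rw [mul_one, coord_one] at h3
    rw [mk_eq_mk_one_iff.mpr ht, ← ht.eq] at h1
    rw [mem_walls] at hy ⊢
    omega
  have hpow : ∀ n : ℕ, conj Γ (gen Γ v ^ n) x ∈ walls t := by
    intro n
    induction n with
    | zero => simpa [conj_one] using hx
    | succ n ih => rw [pow_succ, ← conj_conj]; exact hinv _ ih
  have hfin := (walls_finite t).to_subtype
  obtain ⟨m, n, hmn, heq⟩ := Finite.exists_ne_map_eq_of_infinite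
    (fun n : ℕ => (⟨conj Γ (gen Γ v ^ n) x, hpow n⟩ : walls t))
  simp only [Subtype.mk.injEq] at heq
  rw [conj_eq_iff, conj_conj, ← val_inj] at heq
  have hN : ((n : ℤ) - m) ≠ 0 := by omega
  refine commute_of_commute_zpow hN ?_
  rw [zpow_sub, zpow_natCast, zpow_natCast]
  simp only [conj] at heq
  rw [eq_comm, mul_assoc, inv_mul_eq_iff_eq_mul] at heq
  exact heq

theorem commute_of_coord_ne {v : V} {g h : RAAG Γ} (hgh : mk Γ v g = mk Γ v h) {y : ExtVertex Γ}
    (hy : coord g y ≠ coord h y) : Commute y.1 (mk Γ v h).1 := by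
  have ht := mk_eq_mk_iff.mp hgh
  have h1 := coord_mul (g * h⁻¹) h y
  rw [inv_mul_cancel_right] at h1
  have h2 : conj Γ h⁻¹ y ∈ walls (g * h⁻¹) := by rw [mem_walls]; omega
  have h3 := (commute_conj Γ h (conj Γ h⁻¹ y) (mk Γ v 1)).mpr
    (by rw [mk_one_val]; exact commute_of_mem_walls ht h2)
  rwa [conj_conj, inv_mul_cancel, conj_one, conj_mk, one_mul] at h3

/-- Induction for elements all of whose walls commute with the vertex `v`. -/
theorem induction_commute_walls {v : V} {P : RAAG Γ → Prop} (one : P 1)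
    (mul : ∀ u (k : ℤ) h, Commute (gen Γ u) (gen Γ v) → Commute h (gen Γ v) → P h →
      P (gen Γ u ^ k * h)) (t : RAAG Γ) (ht : ∀ x ∈ walls t, Commute x.1 (gen Γ v)) :
    Commute t (gen Γ v) ∧ P t := by
  induction t using induction_reduced with
  | one => exact ⟨Commute.one_left _, one⟩
  | mul u k h hk hx ih =>
    rw [walls_zpow_mul hk hx] at ht
    obtain ⟨hc, hP⟩ := ih fun x hx => ht x (Or.inr hx)
    have hu := ht _ (Or.inl rfl)
    have hvh : (mk Γ v h).1 = gen Γ v := by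
      rw [mk_eq_mk_one_iff.mpr hc, mk_one_val]
    rw [← hvh, commute_mk_mk] at hu
    exact ⟨(hu.zpow_left k).mul_left hc, mul u k h hu hc hP⟩

/-- In effect, the centralizer of v is generated by the vertices commuting with v. -/
theorem induction_centralizer {v : V} {P : RAAG Γ → Prop} (one : P 1)
    (mul : ∀ u (k : ℤ) h, Commute (gen Γ u) (gen Γ v) → Commute h (gen Γ v) → P h →
      P (gen Γ u ^ k * h)) (t : RAAG Γ) (ht : Commute t (gen Γ v)) : P t :=
  (induction_commute_walls one mul t fun _ hx => commute_of_mem_walls ht hx).2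

/-- If all walls between `g` and `h` commute with `v^h`, then `v^g = v^h`. -/
theorem mk_eq_mk_of_coord {v : V} {g h : RAAG Γ}
    (H : ∀ y, coord g y ≠ coord h y → Commute y.1 (mk Γ v h).1) : mk Γ v g = mk Γ v h := by
  rw [mk_eq_mk_iff]
  refine (induction_commute_walls (P := fun _ => True) trivial (fun _ _ _ _ _ _ => trivial)
    (g * h⁻¹) fun x hx => ?_).1
  have h1 := coord_mul (g * h⁻¹) h (conj Γ h x)
  rw [inv_mul_cancel_right, conj_conj, mul_inv_cancel, conj_one] at h1
  have h2 := H (conj Γ h x) (by rw [mem_walls] at hx; omega)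
  have h3 := (commute_conj Γ h x (mk Γ v 1)).mp (by rwa [conj_mk, one_mul])
  rwa [mk_one_val] at h3

/-! ### Crossing walls -/

/-- Walls which do not commute are nested. -/
theorem exists_nested {x y : ExtVertex Γ} (hxy : ¬ Commute x.1 y.1) :
    ∃ a b : ℤ, ∀ h : RAAG Γ, coord h x = a ∨ coord h y = b := by
  obtain ⟨v, p, rfl⟩ := exists_mk x
  obtain ⟨w, q, rfl⟩ := exists_mk y
  have hne : mk Γ v p ≠ mk Γ w q := by
    intro h; rw [h] at hxy; exact hxy (Commute.refl _)
  -- The level of each wall is read off at a chamber where the other one can be crossed. All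
  -- chambers adjacent to x lie at the same level of y, as walls between them commute with x; so a
  -- step across x preserves the alternative, and symmetrically for y.
  refine ⟨coord q (mk Γ v p), coord p (mk Γ w q), fun h => ?_⟩
  refine (const_of_step (P := fun h => coord h (mk Γ v p) = coord q (mk Γ v p) ∨
    coord h (mk Γ w q) = coord p (mk Γ w q)) (fun u h => ?_) h p).mpr (Or.inr rfl)
  have hv : mk Γ u h = mk Γ v p → coord h (mk Γ w q) = coord p (mk Γ w q) := by
    intro H
    obtain rfl := mk_inj_left H
    by_contra hc
    exact hxy (commute_of_coord_ne H hc).symm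
  have hw : mk Γ u h = mk Γ w q → coord h (mk Γ v p) = coord q (mk Γ v p) := by
    intro H
    obtain rfl := mk_inj_left H
    by_contra hc
    exact hxy (commute_of_coord_ne H hc)
  rw [coord_gen_mul, coord_gen_mul]
  by_cases h1 : mk Γ u h = mk Γ v p
  · have h2 : mk Γ u h ≠ mk Γ w q := fun h2 => hne (h1.symm.trans h2)
    simp [h2, hv h1]
  · by_cases h2 : mk Γ u h = mk Γ w q
    · simp [h1, hw h2]
    · simp [h1, h2]

open Classical in
/-- The homomorphism killing the vertices that do not commute with `v`. -/
noncomputable def retractCentralizer (Γ : SimpleGraph V) (v : V) : RAAG Γ →* RAAG Γ :=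
  lift (fun u => if Commute (gen Γ u) (gen Γ v) then gen Γ u else 1) (fun u w huw => by
    have := commute_gen huw
    split_ifs <;> simp [this])

theorem retractCentralizer_commute (v : V) (g : RAAG Γ) :
    Commute (retractCentralizer Γ v g) (gen Γ v) := by
  induction g using induction_zpow with
  | one => simp
  | mul u k h ih =>
    rw [map_mul, map_zpow]
    refine Commute.mul_left (Commute.zpow_left ?_ k) ih
    rw [retractCentralizer, lift_gen]
    split_ifs with h
    · exact h
    · exact Commute.one_left _

theorem retractCentralizer_of_commute {v : V} {t : RAAG Γ} (ht : Commute t (gen Γ v)) :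
    retractCentralizer Γ v t = t := by
  refine induction_centralizer (P := fun t => retractCentralizer Γ v t = t) (map_one _) ?_ t ht
  intro u k h hu _ ih
  rw [map_mul, map_zpow, ih, retractCentralizer, lift_gen, if_pos hu]

/-- Commuting walls lie in a common translate of `Γ`. -/
theorem exists_common_chamber {x y : ExtVertex Γ} (hxy : Commute x.1 y.1) :
    ∃ u v k, x = mk Γ u k ∧ y = mk Γ v k := by
  obtain ⟨v, q, rfl⟩ := exists_mk y
  obtain ⟨u, p, hp⟩ := exists_mk (conj Γ q⁻¹ x)
  have hc : Commute (mk Γ u p).1 (gen Γ v) := by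
    rw [← hp]
    have := (commute_conj Γ q⁻¹ _ _).mpr hxy
    rwa [conj_mk, mul_inv_cancel, mk_one_val] at this
  have hr := retractCentralizer_of_commute hc
  -- Otherwise the retraction kills u, hence also its conjugate u^p, which it fixes.
  have hu : Commute (gen Γ u) (gen Γ v) := by
    by_contra hu
    have h1 : retractCentralizer Γ v (gen Γ u) = 1 := by
      rw [retractCentralizer, lift_gen, if_neg hu]
    simp only [mk_val, map_mul, map_inv, h1, mul_one, inv_mul_cancel] at hr
    refine gen_ne_one (Γ := Γ) u ?_
    have := hr.symm
    rwa [mul_assoc, inv_mul_eq_one, right_eq_mul] at this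
  have hk := retractCentralizer_commute v p
  -- Applying the retraction replaces p by an element of the centralizer of v, which changes neither
  -- u^p nor v.
  refine ⟨u, v, retractCentralizer Γ v p * q, ?_, (mk_mul_of_commute hk q).symm⟩
  rw [conj_eq_iff, inv_inv] at hp
  rw [hp, mk_mul]
  congr 1
  rw [← val_inj, ← hr]
  simp only [mk_val, map_mul, map_inv, retractCentralizer_of_commute hu]

end RAAG

end Basic

/-! ### Meets, intervals and the retraction of Γᵉ onto Λ_g. -/

section Retraction

variable {V : Type*} {Γ : SimpleGraph V}

namespace RAAG

open ExtVertex

open Classical in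
/-- `m` is the largest common initial part of `g` and `h`. -/
def IsMeet (g h m : RAAG Γ) : Prop :=
  ∀ x, coord m x = if coord h x = coord g x then coord g x else 0

theorem IsMeet.unique {g h m m' : RAAG Γ} (H : IsMeet g h m) (H' : IsMeet g h m') : m = m' :=
  coord_injective (funext fun x => (H x).trans (H' x).symm)

/-- A wall between m and h has a nonzero level at h different from its level at g. If it did not
commute with v^h, nestedness at h and v * h would fix its level there, and then nestedness at 1 and
g would force the coordinate of g at v^h to be 0. -/
theorem IsMeet.mk_eq {g h m : RAAG Γ} (H : IsMeet g h m) {v : V}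
    (hv : coord g (mk Γ v h) ≠ 0) : mk Γ v m = mk Γ v h := by
  refine mk_eq_mk_of_coord fun y hy => ?_
  by_contra hc
  obtain ⟨a, b, hab⟩ := exists_nested hc
  have hne : mk Γ v h ≠ y := by
    rintro rfl; exact hc (Commute.refl _)
  have h0 := hab 1
  have h1 := hab h
  have h2 := hab (gen Γ v ^ (1 : ℤ) * h)
  have h3 := hab g
  rw [coord_zpow_mul_self, coord_zpow_mul_of_ne hne] at h2
  rw [coord_one, coord_one] at h0
  rw [H y] at hy
  split_ifs at hy <;> omega

theorem IsMeet.zpow_mul {g h m : RAAG Γ} (H : IsMeet g h m) (v : V) (k : ℤ) :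
    ∃ j : ℤ, IsMeet g (gen Γ v ^ k * h) (gen Γ v ^ j * m) := by
  classical
  by_cases hv : coord g (mk Γ v h) = 0
  · refine ⟨0, fun x => ?_⟩
    rw [zpow_zero, one_mul, H x]
    by_cases hx : mk Γ v h = x
    · rw [← hx, hv]; simp
    · rw [coord_zpow_mul_of_ne hx]
  · have hm := H.mk_eq hv
    -- The exponent is the coordinate required of the new meet at this wall minus that of the old
    -- one.
    refine ⟨(if coord h (mk Γ v h) + k = coord g (mk Γ v h) then coord g (mk Γ v h) else 0) -
      coord m (mk Γ v h), fun x => ?_⟩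
    by_cases hx : mk Γ v h = x
    · subst hx
      rw [coord_zpow_mul_self, ← hm, coord_zpow_mul_self, hm]
      ring
    · rw [coord_zpow_mul_of_ne hx, coord_zpow_mul_of_ne (hm ▸ hx), H x]

theorem exists_isMeet (g h : RAAG Γ) : ∃ m, IsMeet g h m := by
  induction h using induction_zpow with
  | one =>
    refine ⟨1, fun x => ?_⟩
    simp only [coord_one]
    split_ifs with h
    · exact h
    · rfl
  | mul v k h ih =>
    obtain ⟨m, hm⟩ := ih
    obtain ⟨j, hj⟩ := hm.zpow_mul v k
    exact ⟨_, hj⟩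

/-- The largest common initial part of `g` and `h`. -/
noncomputable def meet (g h : RAAG Γ) : RAAG Γ := (exists_isMeet g h).choose

theorem isMeet_meet (g h : RAAG Γ) : IsMeet g h (meet g h) := (exists_isMeet g h).choose_spec

theorem exists_meet_zpow_mul (g h : RAAG Γ) (v : V) (k : ℤ) :
    ∃ j : ℤ, meet g (gen Γ v ^ k * h) = gen Γ v ^ j * meet g h := by
  obtain ⟨j, hj⟩ := (isMeet_meet g h).zpow_mul v k
  exact ⟨j, (isMeet_meet _ _).unique hj⟩

/-- This makes the retraction well defined on vertices: h and h' differ by an element of the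
centralizer of v, a product of powers of vertices commuting with v, and each such power changes the
meet by a power of the same vertex. -/
theorem mk_meet_eq {g h h' : RAAG Γ} {v : V} (H : mk Γ v h = mk Γ v h') :
    mk Γ v (meet g h) = mk Γ v (meet g h') := by
  have ht := mk_eq_mk_iff.mp H
  have key := induction_centralizer
    (P := fun t => mk Γ v (meet g (t * h')) = mk Γ v (meet g h')) (by rw [one_mul]) (by
      intro u k t hu _ ih
      obtain ⟨j, hj⟩ := exists_meet_zpow_mul g (t * h') u k
      rw [mul_assoc, hj, mk_mul_of_commute (hu.zpow_left j), ih]) _ ht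
  rwa [inv_mul_cancel_right] at key

/-- The elements on syllable geodesics from `1` to `g`. -/
def interval (g : RAAG Γ) : Set (RAAG Γ) :=
  {h | ∀ x, coord h x = 0 ∨ coord h x = coord g x}

theorem one_mem_interval (g : RAAG Γ) : 1 ∈ interval g := fun x => Or.inl (coord_one x)

theorem meet_mem_interval (g h : RAAG Γ) : meet g h ∈ interval g := by
  intro x
  rw [isMeet_meet g h x]
  split_ifs
  · exact Or.inr rfl
  · exact Or.inl rfl

theorem meet_eq_self {g h : RAAG Γ} (hh : h ∈ interval g) : meet g h = h := by
  refine (isMeet_meet g h).unique fun x => ?_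
  split_ifs with h1
  · exact h1
  · exact (hh x).resolve_right h1

theorem interval_walls_subset {g h : RAAG Γ} (hh : h ∈ interval g) : walls h ⊆ walls g := by
  intro x hx
  have := (hh x).resolve_left hx
  rwa [mem_walls, ← this]

theorem interval_finite (g : RAAG Γ) : (interval g).Finite := by
  refine Set.Finite.of_finite_image (f := walls)
    ((walls_finite g).finite_subsets.subset ?_) ?_
  · rintro _ ⟨h, hh, rfl⟩ x hx
    exact interval_walls_subset hh hx
  · intro h hh h' hh' heq
    refine coord_injective (funext fun x => ?_)
    have : coord h x ≠ 0 ↔ coord h' x ≠ 0 := Set.ext_iff.mp heq x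
    rcases hh x with h1 | h1 <;> rcases hh' x with h2 | h2 <;> omega

theorem ncard_walls_mul_inv (g h : RAAG Γ) :
    (walls (g * h⁻¹)).ncard = {x | coord g x ≠ coord h x}.ncard := by
  have : {x | coord g x ≠ coord h x} = conj Γ h '' walls (g * h⁻¹) := by
    ext x
    have h1 := coord_mul (g * h⁻¹) h x
    rw [inv_mul_cancel_right] at h1
    constructor
    · intro hx
      refine ⟨conj Γ h⁻¹ x, ?_, by rw [conj_conj, inv_mul_cancel, conj_one]⟩
      have hx : coord g x ≠ coord h x := hx
      rw [mem_walls]; omega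
    · rintro ⟨y, hy, rfl⟩
      rw [conj_conj, mul_inv_cancel, conj_one] at h1
      rw [mem_walls] at hy
      change coord g _ ≠ coord h _
      omega
  rw [this, Set.ncard_image_of_injective _ (conj_injective h)]

theorem mem_interval_iff {g h : RAAG Γ} :
    h ∈ interval g ↔ sylLength Γ (g * h⁻¹) + sylLength Γ h ≤ sylLength Γ g := by
  rw [sylLength_eq_ncard_walls, sylLength_eq_ncard_walls, sylLength_eq_ncard_walls,
    ncard_walls_mul_inv]
  have hfin : {x | coord g x ≠ coord h x}.Finite :=
    ((walls_finite g).union (walls_finite h)).subset fun x hx => by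
      have hx : coord g x ≠ coord h x := hx
      simp only [Set.mem_union, mem_walls]; omega
  constructor
  · intro hh
    rw [← Set.ncard_union_eq _ hfin (walls_finite h)]
    · refine Set.ncard_le_ncard ?_ (walls_finite g)
      rintro x (hx | hx)
      · have hx : coord g x ≠ coord h x := hx
        have := hh x
        rw [mem_walls]; omega
      · exact interval_walls_subset hh hx
    · rw [Set.disjoint_left]
      intro x hx hx'
      exact hx ((hh x).resolve_left hx').symm
  · intro hle x
    by_contra hx
    rw [not_or] at hx
    -- A wall x that violates the alternative is both a wall of h and a wall between g and h, so
    -- dropping it from the walls of h still leaves a cover of the walls of g, and the count becomes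
    -- strict.
    have hsub : walls g ⊆ {x | coord g x ≠ coord h x} ∪ walls h \ {x} := by
      intro y hy
      by_cases hy' : coord g y = coord h y
      · refine Or.inr ⟨?_, ?_⟩
        · rw [mem_walls] at hy ⊢; omega
        · rintro rfl; exact hx.2 hy'.symm
      · exact Or.inl hy'
    have h1 := Set.ncard_le_ncard hsub (hfin.union ((walls_finite h).sdiff))
    have h2 := Set.ncard_union_le {x | coord g x ≠ coord h x} (walls h \ {x})
    have h3 := Set.ncard_sdiff_singleton_lt_of_mem (s := walls h) (a := x) hx.1 (walls_finite h)
    omega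

theorem mem_interval_iff_suffix {g h : RAAG Γ} :
    h ∈ interval g ↔
      ∃ l, IsSyllableDecomposition Γ l g ∧ ∃ t, t <:+ l ∧ t.prod = h := by
  constructor
  · intro hh
    obtain ⟨a, ha, ha', hal⟩ := exists_list (g * h⁻¹)
    obtain ⟨b, hb, hb', hbl⟩ := exists_list h
    have hprod : (a ++ b).prod = g := by simp [ha', hb']
    have hsyl : ∀ s ∈ a ++ b, IsSyllable Γ s := by
      intro s hs
      rcases List.mem_append.mp hs with hs | hs
      · exact ha s hs
      · exact hb s hs
    refine ⟨a ++ b, ⟨hsyl, hprod, ?_⟩, b, List.suffix_append _ _, hb'⟩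
    have h1 := mem_interval_iff.mp hh
    have h2 := ncard_walls_le_length (a ++ b) hsyl
    rw [hprod] at h2
    rw [sylLength_eq_ncard_walls, sylLength_eq_ncard_walls, sylLength_eq_ncard_walls] at h1
    rw [sylLength_eq_ncard_walls]
    rw [List.length_append] at *
    omega
  · rintro ⟨_, ⟨hl, hprod, hlen⟩, b, ⟨a, rfl⟩, rfl⟩
    rw [mem_interval_iff]
    rw [List.prod_append] at hprod
    rw [← hlen, ← hprod, mul_inv_cancel_right, sylLength_eq_ncard_walls,
      sylLength_eq_ncard_walls, List.length_append]
    exact Nat.add_le_add (ncard_walls_le_length a fun s hs => hl s (by simp [hs]))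
      (ncard_walls_le_length b fun s hs => hl s (by simp [hs]))

/-! ### Unions of translates of `Γ` -/

/-- The union of the translates `Γ^h` for `h` in `H`. -/
def chamberUnion (Γ : SimpleGraph V) (H : Set (RAAG Γ)) : (extensionGraph Γ).Subgraph :=
  ⨆ h ∈ H, gammaTranslate Γ h

theorem mem_gammaTranslate {h : RAAG Γ} {x : ExtVertex Γ} :
    x ∈ (gammaTranslate Γ h).verts ↔ ∃ v, mk Γ v h = x := Iff.rfl

theorem gammaTranslate_adj {h : RAAG Γ} {x y : ExtVertex Γ} :
    (gammaTranslate Γ h).Adj x y ↔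
      (∃ v, mk Γ v h = x) ∧ (∃ v, mk Γ v h = y) ∧ (extensionGraph Γ).Adj x y := Iff.rfl

theorem mem_chamberUnion {H : Set (RAAG Γ)} {x : ExtVertex Γ} :
    x ∈ (chamberUnion Γ H).verts ↔ ∃ h ∈ H, ∃ v, mk Γ v h = x := by
  simp only [chamberUnion, SimpleGraph.Subgraph.verts_iSup, Set.mem_iUnion, mem_gammaTranslate,
    exists_prop]

theorem chamberUnion_adj {H : Set (RAAG Γ)} {x y : ExtVertex Γ} :
    (chamberUnion Γ H).Adj x y ↔ ∃ h ∈ H, (gammaTranslate Γ h).Adj x y := by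
  simp only [chamberUnion, SimpleGraph.Subgraph.iSup_adj, exists_prop]

theorem chamberUnion_mono {H K : Set (RAAG Γ)} (hHK : H ⊆ K) :
    chamberUnion Γ H ≤ chamberUnion Γ K :=
  biSup_mono hHK

theorem gammaTranslate_le_chamberUnion {H : Set (RAAG Γ)} {h : RAAG Γ} (hh : h ∈ H) :
    gammaTranslate Γ h ≤ chamberUnion Γ H :=
  le_biSup (gammaTranslate Γ) hh

theorem translate_gammaTranslate (g h : RAAG Γ) :
    translateSubgraph (extAction Γ) g (gammaTranslate Γ h) = gammaTranslate Γ (h * g) := by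
  have hv : ∀ x, (∃ v, mk Γ v h = x) ↔ ∃ v, mk Γ v (h * g) = conj Γ g x := by
    intro x
    refine exists_congr fun v => ?_
    rw [← conj_mk, (conj_injective g).eq_iff]
  have hsurj : ∀ x, ∃ x', conj Γ g x' = x := (conjIso Γ g).surjective
  ext x y
  · obtain ⟨x, rfl⟩ := hsurj x
    change (∃ x', (∃ v, mk Γ v h = x') ∧ conj Γ g x' = conj Γ g x) ↔ _
    rw [mem_gammaTranslate, ← hv]
    simp only [(conj_injective g).eq_iff, exists_eq_right]
  · obtain ⟨x, rfl⟩ := hsurj x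
    obtain ⟨y, rfl⟩ := hsurj y
    change (∃ x' y', (gammaTranslate Γ h).Adj x' y' ∧ conj Γ g x' = conj Γ g x ∧
      conj Γ g y' = conj Γ g y) ↔ _
    simp only [(conj_injective g).eq_iff]
    rw [gammaTranslate_adj, ← hv, ← hv, show (extensionGraph Γ).Adj (conj Γ g x) (conj Γ g y) ↔
      (extensionGraph Γ).Adj x y from (conjIso Γ g).map_adj_iff, ← gammaTranslate_adj]
    constructor
    · rintro ⟨_, _, h, rfl, rfl⟩; exact h
    · intro h; exact ⟨_, _, h, rfl, rfl⟩

theorem translate_chamberUnion (g : RAAG Γ) (H : Set (RAAG Γ)) :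
    translateSubgraph (extAction Γ) g (chamberUnion Γ H) = chamberUnion Γ ((· * g) '' H) := by
  have : translateSubgraph (extAction Γ) g (chamberUnion Γ H) =
      ⨆ h ∈ H, translateSubgraph (extAction Γ) g (gammaTranslate Γ h) := by
    ext x y
    · simp only [translateSubgraph, chamberUnion, SimpleGraph.Subgraph.map_verts,
        SimpleGraph.Subgraph.verts_iSup, Set.image_iUnion]
    · simp only [translateSubgraph, chamberUnion, SimpleGraph.Subgraph.map_adj, Relation.Map,
        SimpleGraph.Subgraph.iSup_adj]
      tauto
  rw [this]
  simp only [translate_gammaTranslate]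
  rw [chamberUnion, iSup_image]

theorem lambdaSubgraph_eq (g : RAAG Γ) : lambdaSubgraph Γ g = chamberUnion Γ (interval g) := by
  refine le_antisymm (sup_le (gammaTranslate_le_chamberUnion (one_mem_interval g)) ?_) ?_
  · refine iSup₂_le fun l hl => iSup₂_le fun t ht => gammaTranslate_le_chamberUnion ?_
    exact mem_interval_iff_suffix.mpr ⟨l, hl, t, ht.1, rfl⟩
  · refine iSup₂_le fun h hh => ?_
    obtain ⟨l, hl, t, ht, rfl⟩ := mem_interval_iff_suffix.mp hh
    by_cases h0 : t = []
    · subst h0; exact le_sup_left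
    · exact le_sup_of_le_right (le_iSup₂_of_le l hl (le_iSup₂_of_le t ⟨ht, h0⟩ le_rfl))

/-! ### Weak convexity -/

theorem adj_mk_mk {u v : V} (h : Γ.Adj u v) (g : RAAG Γ) :
    (extensionGraph Γ).Adj (mk Γ u g) (mk Γ v g) :=
  ⟨fun H => h.ne (mk_inj_left H), commute_mk_mk.mpr (commute_gen h)⟩

theorem extensionGraph_preconnected (hΓ : Γ.Connected) : (extensionGraph Γ).Preconnected := by
  have h1 : ∀ g u v, (extensionGraph Γ).Reachable (mk Γ u g) (mk Γ v g) := fun g u v =>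
    (hΓ.preconnected u v).map (⟨fun u => mk Γ u g, fun h => adj_mk_mk h g⟩ : Γ →g extensionGraph Γ)
  have h2 : ∀ g u v, (extensionGraph Γ).Reachable (mk Γ u g) (mk Γ v 1) := by
    intro g
    induction g using induction_zpow with
    | one => exact h1 1
    | mul w k g ih =>
      intro u v
      have := h1 (gen Γ w ^ k * g) u w
      rw [mk_zpow_mul] at this
      exact this.trans (ih w v)
  intro x y
  obtain ⟨u, g, rfl⟩ := exists_mk x
  obtain ⟨v, h, rfl⟩ := exists_mk y
  exact (h2 g u v).trans (h2 h v v).symm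

/-- The map v^h ↦ v^(meet g h) preserves adjacency, because adjacent vertices share a chamber, and
it fixes Λ_g. The image of a geodesic is a walk of the same length inside Λ_g. -/
theorem isWeaklyConvex_interval (hΓ : Γ.Connected) (g : RAAG Γ) :
    IsWeaklyConvex (chamberUnion Γ (interval g)) := by
  have hf : ∀ x : ExtVertex Γ, ∃ y : ExtVertex Γ, ∀ v h, x = mk Γ v h → y = mk Γ v (meet g h) := by
    intro x
    obtain ⟨v, h, rfl⟩ := exists_mk x
    refine ⟨mk Γ v (meet g h), fun w h' H => ?_⟩
    obtain rfl := mk_inj_left H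
    exact mk_meet_eq H
  choose f hf using hf
  have hfix : ∀ x ∈ (chamberUnion Γ (interval g)).verts, f x = x := by
    intro x hx
    obtain ⟨h, hh, v, rfl⟩ := mem_chamberUnion.mp hx
    rw [hf _ v h rfl, meet_eq_self hh]
  have hadj : ∀ x y, (extensionGraph Γ).Adj x y →
      (chamberUnion Γ (interval g)).Adj (f x) (f y) := by
    rintro x y ⟨hne, hc⟩
    obtain ⟨u, v, k, rfl, rfl⟩ := exists_common_chamber hc
    rw [hf _ u k rfl, hf _ v k rfl]
    refine chamberUnion_adj.mpr ⟨meet g k, meet_mem_interval g k, ⟨u, rfl⟩, ⟨v, rfl⟩, ?_, ?_⟩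
    · intro H; exact hne (by rw [mk_inj_left H])
    · exact commute_mk_mk.mpr (commute_mk_mk.mp hc)
  have hmem : ∀ x, f x ∈ (chamberUnion Γ (interval g)).verts := by
    intro x
    obtain ⟨v, h, rfl⟩ := exists_mk x
    rw [hf _ v h rfl]
    exact mem_chamberUnion.mpr ⟨_, meet_mem_interval g h, v, rfl⟩
  let F : extensionGraph Γ →g extensionGraph Γ :=
    ⟨f, fun h => (chamberUnion Γ (interval g)).adj_sub (hadj _ _ h)⟩
  intro x hx y hy
  obtain ⟨p, hp⟩ := (extensionGraph_preconnected hΓ x y).exists_walk_length_eq_dist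
  refine ⟨(p.map F).copy (hfix x hx) (hfix y hy), by simp [hp], ?_⟩
  have : ∀ {x y} (p : (extensionGraph Γ).Walk x y),
      (p.map F).toSubgraph ≤ chamberUnion Γ (interval g) := by
    intro x y p
    induction p with
    | nil =>
      rw [SimpleGraph.Walk.map_nil]
      exact (SimpleGraph.singletonSubgraph_le_iff _ _).mpr (hmem _)
    | cons h p ih =>
      rw [SimpleGraph.Walk.map_cons]
      exact sup_le (SimpleGraph.subgraphOfAdj_le_of_adj _ (hadj _ _ h)) ih
  have h2 : ∀ {x y x' y'} (q : (extensionGraph Γ).Walk x y) (h : x = x') (h' : y = y'),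
      (q.copy h h').toSubgraph = q.toSubgraph := by
    rintro x y _ _ q rfl rfl; rfl
  rw [h2]
  exact this p

end RAAG

end Retraction

/-! ### Loxodromic elements and axial subgraphs of general actions -/

section GeneralActions

variable {G : Type*} [Group G] {X : Type*} {𝒢 : SimpleGraph X} {ρ : Gᵐᵒᵖ →* (𝒢 ≃g 𝒢)}

theorem SimpleGraph.Iso.dist_apply (φ : 𝒢 ≃g 𝒢) (x y : X) :
    𝒢.dist (φ x) (φ y) = 𝒢.dist x y := by
  have key : ∀ (φ : 𝒢 ≃g 𝒢) x y, 𝒢.Reachable x y → 𝒢.dist (φ x) (φ y) ≤ 𝒢.dist x y := by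
    intro φ x y h
    obtain ⟨p, hp⟩ := h.exists_walk_length_eq_dist
    rw [← hp, ← SimpleGraph.Walk.length_map φ.toHom p]
    exact SimpleGraph.dist_le _
  by_cases h : 𝒢.Reachable x y
  · refine le_antisymm (key φ x y h) ?_
    have := key φ.symm (φ x) (φ y) (h.map φ.toHom)
    simpa using this
  · rw [SimpleGraph.dist_eq_zero_of_not_reachable h, SimpleGraph.dist_eq_zero_of_not_reachable]
    intro h'
    have := h'.map φ.symm.toHom
    exact h (by simpa using this)

theorem act_mul (ρ : Gᵐᵒᵖ →* (𝒢 ≃g 𝒢)) (g h : G) (x : X) :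
    ρ (op (g * h)) x = ρ (op h) (ρ (op g) x) := by
  rw [op_mul, map_mul]; rfl

theorem act_one (ρ : Gᵐᵒᵖ →* (𝒢 ≃g 𝒢)) (x : X) : ρ (op 1) x = x := by
  rw [op_one, map_one]; rfl

theorem act_inv_act (ρ : Gᵐᵒᵖ →* (𝒢 ≃g 𝒢)) (g : G) (x : X) : ρ (op g⁻¹) (ρ (op g) x) = x := by
  rw [← act_mul, mul_inv_cancel, act_one]

theorem act_act_inv (ρ : Gᵐᵒᵖ →* (𝒢 ≃g 𝒢)) (g : G) (x : X) : ρ (op g) (ρ (op g⁻¹) x) = x := by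
  rw [← act_mul, inv_mul_cancel, act_one]

theorem IsLoxodromic.eventually_lt_dist {g : G} (hg : IsLoxodromic ρ g) (x : X) (C : ℕ) :
    ∀ᶠ n : ℕ in atTop, C < 𝒢.dist x (ρ (op (g ^ n)) x) := by
  obtain ⟨τ, hτ, h⟩ := hg
  have h1 := (h x).eventually_const_lt (half_lt_self hτ)
  have h2 := tendsto_natCast_atTop_atTop (R := ℝ) |>.eventually_ge_atTop (2 * C / τ)
  filter_upwards [h1, h2, eventually_gt_atTop 0] with n hn1 hn2 hn0
  have hn : (0 : ℝ) < n := by exact_mod_cast hn0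
  rw [lt_div_iff₀ hn] at hn1
  rw [div_le_iff₀ hτ] at hn2
  have : (C : ℝ) < 𝒢.dist x (ρ (op (g ^ n)) x) := by nlinarith
  exact_mod_cast this

theorem IsLoxodromic.act_zpow_ne {g : G} (hg : IsLoxodromic ρ g) {k : ℤ} (hk : k ≠ 0) (x : X) :
    ρ (op (g ^ k)) x ≠ x := by
  intro hfix
  have hnat : ρ (op (g ^ k.natAbs)) x = x := by
    rcases Int.natAbs_eq k with h | h
    · rw [h, zpow_natCast] at hfix; exact hfix
    · rw [h, zpow_neg, zpow_natCast] at hfix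
      have := act_act_inv ρ (g ^ k.natAbs) x
      rwa [hfix] at this
  have hmul : ∀ j : ℕ, ρ (op (g ^ (k.natAbs * j))) x = x := by
    intro j
    induction j with
    | zero => simp
    | succ j ih => rw [Nat.mul_succ, pow_add, act_mul, ih, hnat]
  obtain ⟨N, hN⟩ := eventually_atTop.mp (hg.eventually_lt_dist x 0)
  have := hN (k.natAbs * N) (Nat.le_mul_of_pos_left N (Int.natAbs_pos.mpr hk))
  rw [hmul, SimpleGraph.dist_self] at this
  exact lt_irrefl _ this

theorem IsLoxodromic.act_zpow_injective {g : G} (hg : IsLoxodromic ρ g) (x : X) :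
    Function.Injective fun k : ℤ => ρ (op (g ^ k)) x := by
  intro j k hjk
  by_contra hne
  refine hg.act_zpow_ne (sub_ne_zero.mpr hne) x ?_
  have hjk : ρ (op (g ^ j)) x = ρ (op (g ^ k)) x := hjk
  rw [zpow_sub, act_mul, hjk, act_inv_act]

theorem IsLoxodromic.conj {g : G} (hg : IsLoxodromic ρ g) (h : G) :
    IsLoxodromic ρ (h⁻¹ * g * h) := by
  obtain ⟨τ, hτ, H⟩ := hg
  refine ⟨τ, hτ, fun x => ?_⟩
  refine (H (ρ (op h⁻¹) x)).congr fun n => ?_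
  have h1 : (h⁻¹ * g * h) ^ n = h⁻¹ * g ^ n * h := by
    simpa using conj_pow (a := h⁻¹) (b := g) (i := n)
  rw [h1, act_mul, act_mul, ← SimpleGraph.Iso.dist_apply (ρ (op h)), act_act_inv]

theorem translateSubgraph_mul (ρ : Gᵐᵒᵖ →* (𝒢 ≃g 𝒢)) (g h : G) (A : 𝒢.Subgraph) :
    translateSubgraph ρ (g * h) A = translateSubgraph ρ h (translateSubgraph ρ g A) := by
  rw [translateSubgraph, translateSubgraph, translateSubgraph, ← SimpleGraph.Subgraph.map_comp]
  congr 1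
  ext x
  exact act_mul ρ g h x

theorem translateSubgraph_one (ρ : Gᵐᵒᵖ →* (𝒢 ≃g 𝒢)) (A : 𝒢.Subgraph) :
    translateSubgraph ρ 1 A = A := by
  conv_rhs => rw [← SimpleGraph.Subgraph.map_id A]
  rw [translateSubgraph]
  congr 1
  ext x
  exact act_one ρ x

theorem translateSubgraph_mono (ρ : Gᵐᵒᵖ →* (𝒢 ≃g 𝒢)) (g : G) {A B : 𝒢.Subgraph} (h : A ≤ B) :
    translateSubgraph ρ g A ≤ translateSubgraph ρ g B :=
  SimpleGraph.Subgraph.map_mono h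

theorem translateSubgraph_le_iff {g : G} {A B : 𝒢.Subgraph} :
    translateSubgraph ρ g A ≤ B ↔ A ≤ translateSubgraph ρ g⁻¹ B := by
  constructor
  · intro h
    have := translateSubgraph_mono ρ g⁻¹ h
    rwa [← translateSubgraph_mul, mul_inv_cancel, translateSubgraph_one] at this
  · intro h
    have := translateSubgraph_mono ρ g h
    rwa [← translateSubgraph_mul, inv_mul_cancel, translateSubgraph_one] at this

theorem translateSubgraph_iSup {ι : Sort*} (g : G) (A : ι → 𝒢.Subgraph) :
    translateSubgraph ρ g (⨆ i, A i) = ⨆ i, translateSubgraph ρ g (A i) := by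
  refine le_antisymm ?_ (iSup_le fun i => translateSubgraph_mono ρ g (le_iSup A i))
  rw [translateSubgraph_le_iff]
  refine iSup_le fun i => ?_
  rw [← translateSubgraph_le_iff]
  exact le_iSup (fun i => translateSubgraph ρ g (A i)) i

theorem translateSubgraph_zpow {g : G} {A : 𝒢.Subgraph} (h : translateSubgraph ρ g A = A) (k : ℤ) :
    translateSubgraph ρ (g ^ k) A = A := by
  have hinv : translateSubgraph ρ g⁻¹ A = A := by
    conv_lhs => rw [← h]
    rw [← translateSubgraph_mul, mul_inv_cancel, translateSubgraph_one]
  induction k using Int.induction_on with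
  | zero => rw [zpow_zero, translateSubgraph_one]
  | succ n ih => rw [zpow_add, zpow_one, translateSubgraph_mul, ih, h]
  | pred n ih => rw [zpow_sub, zpow_one, translateSubgraph_mul, ih, hinv]

theorem IsWeaklyConvex.translate {A : 𝒢.Subgraph} (hA : IsWeaklyConvex A) (g : G) :
    IsWeaklyConvex (translateSubgraph ρ g A) := by
  rintro _ ⟨x, hx, rfl⟩ _ ⟨y, hy, rfl⟩
  obtain ⟨p, hp, hpA⟩ := hA x hx y hy
  refine ⟨p.map (ρ (op g)).toHom, ?_, ?_⟩
  · rw [SimpleGraph.Walk.length_map, hp]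
    exact (SimpleGraph.Iso.dist_apply (ρ (op g)) x y).symm
  · rw [SimpleGraph.Walk.toSubgraph_map]
    exact translateSubgraph_mono ρ g hpA

theorem IsAxialSubgraph.translate {g : G} {A : 𝒢.Subgraph} (hA : IsAxialSubgraph ρ g A) (h : G) :
    IsAxialSubgraph ρ (h⁻¹ * g * h) (translateSubgraph ρ h A) where
  nonempty := hA.nonempty.image _
  weaklyConvex := hA.weaklyConvex.translate h
  locallyFinite := by
    rintro _ ⟨x, hx, rfl⟩
    refine ((hA.locallyFinite x hx).image (ρ (op h))).subset ?_
    rintro _ ⟨x', y, hxy, hx', rfl⟩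
    obtain rfl := (ρ (op h)).injective hx'
    exact ⟨y, hxy, rfl⟩
  invariant := by
    rw [← translateSubgraph_mul, mul_assoc, mul_inv_cancel_left, translateSubgraph_mul,
      hA.invariant]
  cocompact := by
    obtain ⟨K, hK, hKA, hcov⟩ := hA.cocompact
    refine ⟨translateSubgraph ρ h K, hK.image _, translateSubgraph_mono ρ h hKA, ?_⟩
    refine (translateSubgraph_mono ρ h hcov).trans ?_
    rw [translateSubgraph_iSup]
    refine iSup_mono fun k => le_of_eq ?_
    have h1 : (h⁻¹ * g * h) ^ k = h⁻¹ * g ^ k * h := by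
      simpa using conj_zpow (a := h⁻¹) (b := g) (i := k)
    rw [h1, ← translateSubgraph_mul, ← translateSubgraph_mul, mul_assoc, mul_inv_cancel_left]

end GeneralActions

/-! ### Width -/

section FiniteWidth

open SimpleGraph

/-- There are then at most two ends. A set S separating one pair of ends separates every pair: if T
separates c and d, then over S ∪ T both pairs realise the same two components, so c and d already
differ over S. -/
theorem exists_graphWidth_le_of_two {X : Type*} (H : SimpleGraph X)
    (h : ∀ S : Finset X, ∃ R L : H.ComponentCompl S, ∀ e ∈ H.end,
      e (Opposite.op S) = R ∨ e (Opposite.op S) = L) :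
    ∃ κ : ℕ, graphWidth H ≤ κ := by
  classical
  have hmono : ∀ (S T : Finset X), S ⊆ T → ∀ e₁ ∈ H.end, ∀ e₂ ∈ H.end,
      e₁ (Opposite.op T) = e₂ (Opposite.op T) → e₁ (Opposite.op S) = e₂ (Opposite.op S) := by
    intro S T hST e₁ h₁ e₂ h₂ heq
    rw [← h₁ (CategoryTheory.opHomOfLE (x := Opposite.op S) (y := Opposite.op T) hST),
      ← h₂ (CategoryTheory.opHomOfLE (x := Opposite.op S) (y := Opposite.op T) hST), heq]
  suffices ∃ S : Finset X, IsEndSeparating H S by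
    obtain ⟨S, hS⟩ := this
    exact ⟨S.card, iInf₂_le S hS⟩
  by_cases hone : ∀ e₁ ∈ H.end, ∀ e₂ ∈ H.end, e₁ = e₂
  · exact ⟨∅, fun e₁ h₁ e₂ h₂ hne => absurd (hone e₁ h₁ e₂ h₂) hne⟩
  push Not at hone
  have hsep : ∀ e₁ ∈ H.end, ∀ e₂ ∈ H.end, e₁ ≠ e₂ →
      ∃ S : Finset X, e₁ (Opposite.op S) ≠ e₂ (Opposite.op S) := by
    intro e₁ _ e₂ _ hne
    by_contra hc
    push Not at hc
    exact hne (funext fun S => hc S.unop)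
  obtain ⟨a, ha, b, hb, hab⟩ := hone
  obtain ⟨S, hS⟩ := hsep a ha b hb hab
  refine ⟨S, fun c hc d hd hcd heq => ?_⟩
  obtain ⟨T, hT⟩ := hsep c hc d hd hcd
  have hab' := fun H' => hS (hmono S (S ∪ T) Finset.subset_union_left a ha b hb H')
  have hcd' := fun H' => hT (hmono T (S ∪ T) Finset.subset_union_right c hc d hd H')
  have hac' := fun H' => hmono S (S ∪ T) Finset.subset_union_left a ha c hc H'
  have had' := fun H' => hmono S (S ∪ T) Finset.subset_union_left a ha d hd H'
  have hbc' := fun H' => hmono S (S ∪ T) Finset.subset_union_left b hb c hc H'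
  have hbd' := fun H' => hmono S (S ∪ T) Finset.subset_union_left b hb d hd H'
  obtain ⟨R, L, hRL⟩ := h (S ∪ T)
  have ra := hRL a ha
  have rb := hRL b hb
  have rc := hRL c hc
  have rd := hRL d hd
  grind

variable {G : Type*} [Group G] {X : Type*} {𝒢 : SimpleGraph X} {ρ : Gᵐᵒᵖ →* (𝒢 ≃g 𝒢)}

theorem componentComplMk_eq_of_walk {A : 𝒢.Subgraph} {S : Finset A.verts} {x y : X}
    (p : 𝒢.Walk x y) (hp : p.toSubgraph ≤ A)
    (hS : ∀ z (hz : z ∈ A.verts), z ∈ p.support → (⟨z, hz⟩ : A.verts) ∉ S)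
    (hx : x ∈ A.verts) (hy : y ∈ A.verts) :
    A.coe.componentComplMk (hS x hx p.start_mem_support) =
      A.coe.componentComplMk (hS y hy p.end_mem_support) := by
  induction p with
  | nil => rfl
  | cons h p ih =>
    have hadj := (le_sup_left.trans hp).2 (SimpleGraph.subgraphOfAdj_adj_self h)
    have hw := A.edge_vert hadj.symm
    have hS' : ∀ z (hz : z ∈ A.verts), z ∈ p.support → (⟨z, hz⟩ : A.verts) ∉ S :=
      fun z hz hzp => hS z hz (by simp [hzp])
    exact (componentComplMk_eq_of_adj A.coe _ (hS' _ hw p.start_mem_support)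
      (by exact hadj)).trans (ih (le_sup_right.trans hp) hS' hw hy)

/-- Choose a path from x to its image under g and paths from x to the vertices of K. Only finitely
many translates of these meet S, so all translates far to the right lie in one component, and
likewise to the left. -/
theorem IsAxialSubgraph.exists_graphWidth_le {g : G} {A : 𝒢.Subgraph}
    (hg : IsLoxodromic ρ g) (hA : IsAxialSubgraph ρ g A) :
    ∃ κ : ℕ, graphWidth A.coe ≤ κ := by
  classical
  refine exists_graphWidth_le_of_two _ fun S => ?_
  obtain ⟨x, hx⟩ := hA.nonempty
  obtain ⟨K, hK, hKA, hcov⟩ := hA.cocompact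
  have hact : ∀ (k : ℤ) {z}, z ∈ A.verts → ρ (op (g ^ k)) z ∈ A.verts := by
    intro k z hz
    rw [← translateSubgraph_zpow hA.invariant k]
    exact ⟨z, hz, rfl⟩
  obtain ⟨q, -, hq⟩ := hA.weaklyConvex x hx (ρ (op g) x) (by simpa using hact 1 hx)
  have hp : ∀ y : X, ∃ l : List X, ∀ hy : y ∈ A.verts, ∃ p : 𝒢.Walk x y, p.toSubgraph ≤ A ∧
      p.support = l := by
    intro y
    by_cases hy : y ∈ A.verts
    · obtain ⟨p, -, hp⟩ := hA.weaklyConvex x hx y hy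
      exact ⟨p.support, fun _ => ⟨p, hp, rfl⟩⟩
    · exact ⟨[], fun h => absurd h hy⟩
  choose l hl using hp
  let P : Set X := {z | z ∈ q.support} ∪ ⋃ y ∈ K.verts, {z | z ∈ l y}
  have hP : P.Finite := (List.finite_toSet _).union (hK.biUnion fun _ _ => List.finite_toSet _)
  let B : Set ℤ := {i | ∃ z ∈ P, ∃ s ∈ S, ρ (op (g ^ i)) z = s.1}
  have hB : B.Finite := by
    have : B ⊆ ⋃ z ∈ P, ⋃ s ∈ (S : Set A.verts), (fun i : ℤ => ρ (op (g ^ i)) z) ⁻¹' {s.1} := by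
      rintro i ⟨z, hz, s, hs, h⟩
      simp only [Set.mem_iUnion]
      exact ⟨z, hz, s, hs, h⟩
    refine Set.Finite.subset ?_ this
    exact hP.biUnion fun z _ => S.finite_toSet.biUnion fun s _ =>
      (Set.finite_singleton _).preimage (hg.act_zpow_injective z).injOn
  obtain ⟨N, hN⟩ : ∃ N : ℕ, ∀ i ∈ B, i.natAbs < N := by
    obtain ⟨N, hN⟩ := (hB.image Int.natAbs).bddAbove
    exact ⟨N + 1, fun i hi => Nat.lt_succ_of_le (hN ⟨i, hi, rfl⟩)⟩
  let C : X → X → Prop := fun y z => ∃ (hy : y ∈ A.verts) (hz : z ∈ A.verts)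
    (hy' : (⟨y, hy⟩ : A.verts) ∉ S) (hz' : (⟨z, hz⟩ : A.verts) ∉ S),
    A.coe.componentComplMk hy' = A.coe.componentComplMk hz'
  have htrans : ∀ {x y z}, C x y → C y z → C x z := by
    rintro x y z ⟨h1, h2, h3, h4, h5⟩ ⟨h1', h2', h3', h4', h5'⟩
    exact ⟨h1, h2', h3, h4', h5.trans h5'⟩
  have hsymm : ∀ {x y}, C x y → C y x := by
    rintro x y ⟨h1, h2, h3, h4, h5⟩
    exact ⟨h2, h1, h4, h3, h5.symm⟩
  have hwalk : ∀ i : ℤ, N ≤ i.natAbs → ∀ (y z : X) (p : 𝒢.Walk y z), p.toSubgraph ≤ A →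
      (∀ w ∈ p.support, w ∈ P) → C (ρ (op (g ^ i)) y) (ρ (op (g ^ i)) z) := by
    intro i hi y z p hpA hpP
    have h1 : (p.map (ρ (op (g ^ i))).toHom).toSubgraph ≤ A := by
      rw [SimpleGraph.Walk.toSubgraph_map, ← translateSubgraph_zpow hA.invariant i]
      exact translateSubgraph_mono ρ _ hpA
    have h2 : ∀ w (hw : w ∈ A.verts), w ∈ (p.map (ρ (op (g ^ i))).toHom).support →
        (⟨w, hw⟩ : A.verts) ∉ S := by
      intro w hw hwp hwS
      rw [SimpleGraph.Walk.support_map, List.mem_map] at hwp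
      obtain ⟨w', hw', rfl⟩ := hwp
      exact (hN i ⟨w', hpP w' hw', _, hwS, rfl⟩).not_ge hi
    have hy := h1.1 (SimpleGraph.Walk.start_mem_verts_toSubgraph _)
    have hz := h1.1 (SimpleGraph.Walk.end_mem_verts_toSubgraph _)
    exact ⟨hy, hz, _, _, componentComplMk_eq_of_walk _ h1 h2 hy hz⟩
  have hstep : ∀ i : ℤ, N ≤ i.natAbs → C (ρ (op (g ^ i)) x) (ρ (op (g ^ (i + 1))) x) := by
    intro i hi
    have := hwalk i hi x _ q hq (fun w hw => Or.inl hw)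
    rwa [← act_mul, ← zpow_one_add, add_comm] at this
  have hKx : ∀ i : ℤ, N ≤ i.natAbs → ∀ y ∈ K.verts,
      C (ρ (op (g ^ i)) x) (ρ (op (g ^ i)) y) := by
    intro i hi y hy
    obtain ⟨p, hpA, hpl⟩ := hl y (hKA.1 hy)
    refine hwalk i hi x y p hpA fun w hw => Or.inr (Set.mem_biUnion hy ?_)
    rw [hpl] at hw; exact hw
  have hright : ∀ n : ℕ, C (ρ (op (g ^ (N : ℤ))) x) (ρ (op (g ^ (N + n : ℤ))) x) := by
    intro n
    induction n with
    | zero =>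
      have := hstep N (by omega)
      simpa using htrans this (hsymm this)
    | succ n ih =>
      have := hstep (N + n) (by omega)
      push_cast
      rw [← add_assoc]
      exact htrans ih this
  have hleft : ∀ n : ℕ, C (ρ (op (g ^ (-N : ℤ))) x) (ρ (op (g ^ (-N - n : ℤ))) x) := by
    intro n
    induction n with
    | zero =>
      have := hstep (-N) (by omega)
      simpa using htrans this (hsymm this)
    | succ n ih =>
      have := hstep (-N - (n + 1 : ℕ)) (by omega)
      rw [show (-N - (n + 1 : ℕ) + 1 : ℤ) = -N - n by push_cast; ring] at this
      exact htrans ih (hsymm this)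
  obtain ⟨hR, -, hR', -⟩ := hright 0
  obtain ⟨hL, -, hL', -⟩ := hleft 0
  refine ⟨A.coe.componentComplMk hR', A.coe.componentComplMk hL', fun e he => ?_⟩
  -- Enlarging S by the middle translates of K forces the component chosen by an end to contain a
  -- vertex of a far translate.
  let T : Set X := ⋃ i ∈ Set.Icc (-N : ℤ) N, ρ (op (g ^ i)) '' K.verts
  have hT : T.Finite := (Set.finite_Icc _ _).biUnion fun _ _ => hK.image _
  have hT' : ((↑) ⁻¹' T : Set A.verts).Finite := hT.preimage Subtype.val_injective.injOn
  obtain ⟨⟨z, hz⟩, hzS, hze⟩ :=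
    ComponentCompl.exists_eq_mk (e (Opposite.op (S ∪ hT'.toFinset)))
  have hzA := hcov.1 hz
  rw [SimpleGraph.Subgraph.verts_iSup, Set.mem_iUnion] at hzA
  obtain ⟨i, y, hy, rfl⟩ := hzA
  have hend := end_hom_mk_of_mk A.coe he
    (CategoryTheory.opHomOfLE (x := Opposite.op S) (y := Opposite.op (S ∪ hT'.toFinset))
      Finset.subset_union_left) hzS hze.symm
  rw [hend]
  have hi : N < i.natAbs := by
    by_contra hi
    refine hzS (Finset.mem_union_right _ (hT'.mem_toFinset.mpr ?_))
    exact Set.mem_biUnion (by constructor <;> omega) ⟨y, hy, rfl⟩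
  have hC := hKx i hi.le y hy
  rcases le_total 0 i with h0 | h0
  · left
    have := hright (i - N).toNat
    rw [show (N + (i - N).toNat : ℤ) = i by omega] at this
    obtain ⟨_, _, _, _, h⟩ := htrans this hC
    exact h.symm
  · right
    have := hleft (-N - i).toNat
    rw [show (-N - (-N - i).toNat : ℤ) = i by omega] at this
    obtain ⟨_, _, _, _, h⟩ := htrans this hC
    exact h.symm

end FiniteWidth

/-! ### The periodic wall sequence of a loxodromic element. -/

section Axis

variable {V : Type*} {Γ : SimpleGraph V}

namespace RAAG

open ExtVertex

/-- The partial products of a sequence of syllables. -/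
def pathProd (Γ : SimpleGraph V) (v : ℕ → V) (k : ℕ → ℤ) : ℕ → RAAG Γ
  | 0 => 1
  | i + 1 => gen Γ (v i) ^ k i * pathProd Γ v k i

/-- The wall crossed by a syllable of a sequence. -/
def pathWall (Γ : SimpleGraph V) (v : ℕ → V) (k : ℕ → ℤ) (i : ℕ) : ExtVertex Γ :=
  mk Γ (v i) (pathProd Γ v k i)

theorem pathProd_congr {v v' : ℕ → V} {k k' : ℕ → ℤ} {n : ℕ}
    (hv : ∀ i < n, v i = v' i) (hk : ∀ i < n, k i = k' i) :
    pathProd Γ v k n = pathProd Γ v' k' n := by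
  induction n with
  | zero => rfl
  | succ n ih =>
    rw [pathProd, pathProd, hv n (by omega), hk n (by omega),
      ih (fun i hi => hv i (by omega)) fun i hi => hk i (by omega)]

theorem exists_pathProd_list [Nonempty V] (l : List (RAAG Γ)) (hl : ∀ s ∈ l, IsSyllable Γ s) :
    ∃ v k, (∀ i, k i ≠ 0) ∧ pathProd Γ v k l.length = l.prod := by
  classical
  induction l with
  | nil => exact ⟨fun _ => Classical.arbitrary V, fun _ => 1, by simp, rfl⟩
  | cons s l ih =>
    obtain ⟨v, k, hk, hprod⟩ := ih fun s hs => hl s (by simp [hs])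
    obtain ⟨u, j, hj, rfl⟩ := hl s (by simp)
    refine ⟨Function.update v l.length u, Function.update k l.length j, fun i => ?_, ?_⟩
    · by_cases hi : i = l.length
      · subst hi; simpa using hj
      · simpa [hi] using hk i
    · rw [List.length_cons, pathProd, List.prod_cons, ← hprod, Function.update_self,
        Function.update_self]
      congr 1
      refine pathProd_congr (fun i hi => ?_) fun i hi => ?_ <;>
        rw [Function.update_of_ne hi.ne]

open Classical in
theorem coord_pathProd_add (v : ℕ → V) (k : ℕ → ℤ) (i d : ℕ) (x : ExtVertex Γ) :
    coord (pathProd Γ v k (i + d)) x = coord (pathProd Γ v k i) x +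
      ∑ l ∈ Finset.Ico i (i + d), if pathWall Γ v k l = x then k l else 0 := by
  induction d with
  | zero => simp
  | succ d ih =>
    rw [← add_assoc, pathProd, coord_zpow_mul, ih, Finset.sum_Ico_succ_top (by omega), add_assoc]
    rfl

theorem coord_pathProd_of_forall_ne {v : ℕ → V} {k : ℕ → ℤ} {i d : ℕ} {x : ExtVertex Γ}
    (hx : ∀ l, i ≤ l → l < i + d → pathWall Γ v k l ≠ x) :
    coord (pathProd Γ v k (i + d)) x = coord (pathProd Γ v k i) x := by
  classical
  rw [coord_pathProd_add v k i d, Finset.sum_eq_zero, add_zero]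
  intro l hl
  rw [Finset.mem_Ico] at hl
  rw [if_neg (hx l hl.1 hl.2)]

theorem coord_pathProd_of_injOn {v : ℕ → V} {k : ℕ → ℤ} {i d j : ℕ}
    (hinj : Set.InjOn (pathWall Γ v k) (Set.Ico i (i + d))) (hj : j ∈ Set.Ico i (i + d)) :
    coord (pathProd Γ v k (i + d)) (pathWall Γ v k j) =
      coord (pathProd Γ v k i) (pathWall Γ v k j) + k j := by
  classical
  rw [coord_pathProd_add v k i d, Finset.sum_eq_single j, if_pos rfl]
  · intro l hl hne
    rw [Finset.mem_Ico] at hl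
    rw [if_neg fun h => hne (hinj hl hj h)]
  · intro h
    exact absurd (Finset.mem_Ico.mpr hj) h

/-- A periodic sequence of syllables with product `g` over a period, crossing no wall twice. -/
structure IsAxis (Γ : SimpleGraph V) (g : RAAG Γ) (v : ℕ → V) (k : ℕ → ℤ) (n : ℕ) : Prop where
  pos : 0 < n
  ne_zero : ∀ i, k i ≠ 0
  periodic_type : ∀ i, v (i + n) = v i
  periodic_exp : ∀ i, k (i + n) = k i
  prod : pathProd Γ v k n = g
  injective : Function.Injective (pathWall Γ v k)

theorem pathProd_add_period {g : RAAG Γ} {v : ℕ → V} {k : ℕ → ℤ} {n : ℕ}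
    (hv : ∀ i, v (i + n) = v i) (hk : ∀ i, k (i + n) = k i) (hg : pathProd Γ v k n = g) (i : ℕ) :
    pathProd Γ v k (i + n) = pathProd Γ v k i * g := by
  induction i with
  | zero => rw [zero_add, hg, pathProd, one_mul]
  | succ i ih => rw [add_right_comm, pathProd, pathProd, ih, hv, hk, mul_assoc]

theorem mk_ne_of_isLoxodromic {g : RAAG Γ} (hg : IsLoxodromic (extAction Γ) g) (v : V)
    (h : RAAG Γ) : mk Γ v (h * g) ≠ mk Γ v h := by
  intro H
  refine hg.act_zpow_ne one_ne_zero (mk Γ v h) ?_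
  rw [zpow_one]
  exact (conj_mk g h v).trans H

/-- A wall crossed twice by a path of syllables, and not in between, commutes with the syllables in
between. -/
theorem mk_eq_pathWall_of_eq {v : ℕ → V} {k : ℕ → ℤ} {i d : ℕ} (hk : ∀ i, k i ≠ 0)
    (hinj : Set.InjOn (pathWall Γ v k) (Set.Ico i (i + d)))
    (heq : pathWall Γ v k i = pathWall Γ v k (i + d)) {e : ℕ} (he : e ≤ d) :
    mk Γ (v i) (pathProd Γ v k (i + e)) = pathWall Γ v k i := by
  have hvv : v i = v (i + d) := mk_inj_left heq
  induction e with
  | zero => rfl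
  | succ e ih =>
    have ih := ih (by omega)
    have hmem : i + e ∈ Set.Ico i (i + d) := ⟨by omega, by omega⟩
    have h1 := coord_pathProd_of_injOn hinj hmem
    have hc : Commute (pathWall Γ v k (i + e)).1 (pathWall Γ v k i).1 := by
      refine commute_of_coord_ne (g := pathProd Γ v k (i + d)) (v := v i) (h := pathProd Γ v k i)
        ?_ ?_
      · have heq' := heq.symm
        rwa [pathWall, ← hvv] at heq'
      · have := hk (i + e)
        omega
    rw [← ih, pathWall, commute_mk_mk] at hc
    rw [← add_assoc, pathProd, mk_mul_of_commute (hc.zpow_left _), ih]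

theorem exists_isAxis [Nonempty V] {g : RAAG Γ} (hc : IsCyclicallySyllableReduced Γ g)
    (hg : IsLoxodromic (extAction Γ) g) : ∃ v k n, IsAxis Γ g v k n := by
  obtain ⟨l, hl, hprod, hlen⟩ := exists_list g
  obtain ⟨v₀, k₀, hk₀, hpath⟩ := exists_pathProd_list l hl
  rw [hprod] at hpath
  set n := l.length
  have hpos : 0 < n := by
    rcases Nat.eq_zero_or_pos n with h0 | h0
    · rw [h0, pathProd] at hpath
      refine absurd ?_ (mk_ne_of_isLoxodromic hg (Classical.arbitrary V) 1)
      rw [← hpath, mul_one]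
    · exact h0
  set v : ℕ → V := fun i => v₀ (i % n) with hv
  set k : ℕ → ℤ := fun i => k₀ (i % n) with hkdef
  have hpv : ∀ i, v (i + n) = v i := fun i => by simp [hv]
  have hpk : ∀ i, k (i + n) = k i := fun i => by simp [hkdef]
  have hk : ∀ i, k i ≠ 0 := fun i => hk₀ _
  have hpg : pathProd Γ v k n = g := by
    rw [← hpath]
    exact pathProd_congr (fun i hi => by simp [hv, Nat.mod_eq_of_lt hi])
      (fun i hi => by simp [hkdef, Nat.mod_eq_of_lt hi])
  have hshift := pathProd_add_period hpv hpk hpg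
  refine ⟨v, k, n, hpos, hk, hpv, hpk, hpg, ?_⟩
  have hperiod : ∀ i, Set.InjOn (pathWall Γ v k) (Set.Ico i (i + n)) := by
    intro i
    -- The product of the syllables in a window of length n is a conjugate of g, so by cyclic
    -- reducedness the window crosses at least n, hence n distinct, walls.
    have h1 : n ≤ {x | coord (pathProd Γ v k (i + n)) x ≠ coord (pathProd Γ v k i) x}.ncard := by
      rw [← ncard_walls_mul_inv, ← sylLength_eq_ncard_walls, hshift, hlen,
        ← sylLength_eq_ncard_walls]
      simpa using hc (pathProd Γ v k i)⁻¹
    have h2 : {x | coord (pathProd Γ v k (i + n)) x ≠ coord (pathProd Γ v k i) x} ⊆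
        pathWall Γ v k '' (Set.Ico i (i + n)) := by
      intro x hx
      by_contra hx'
      refine hx (coord_pathProd_of_forall_ne fun l h1 h2 h3 => hx' ⟨l, ⟨h1, h2⟩, h3⟩)
    have h3 := Set.ncard_le_ncard h2 ((Set.finite_Ico _ _).image _)
    have h4 : (Set.Ico i (i + n)).ncard = n := by
      rw [← Finset.coe_Ico, Set.ncard_coe_finset]; simp
    refine Set.injOn_of_ncard_image_eq ?_ (Set.finite_Ico _ _)
    have h5 := Set.ncard_image_le (f := pathWall Γ v k) (Set.finite_Ico i (i + n))
    omega
  by_contra hninj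
  have hex : ∃ d, 0 < d ∧ ∃ i, pathWall Γ v k i = pathWall Γ v k (i + d) := by
    rw [Function.Injective] at hninj
    push Not at hninj
    obtain ⟨i, j, hij, hne⟩ := hninj
    rcases lt_or_gt_of_ne hne with h | h
    · exact ⟨j - i, by omega, i, by rw [hij]; congr 1; omega⟩
    · exact ⟨i - j, by omega, j, by rw [← hij]; congr 1; omega⟩
  classical
  obtain ⟨hd, i, hi⟩ := Nat.find_spec hex
  have hmin := fun d (hd : d < Nat.find hex) => Nat.find_min hex hd
  set d := Nat.find hex
  by_cases hdn : d < n
  · have := hperiod i ⟨le_rfl, by omega⟩ ⟨by omega, by omega⟩ hi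
    omega
  · have hinj : Set.InjOn (pathWall Γ v k) (Set.Ico i (i + d)) := by
      intro a ha b hb hab
      by_contra hne
      simp only [Set.mem_Ico] at ha hb
      rcases lt_or_gt_of_ne hne with h | h
      · refine hmin (b - a) (by omega) ⟨by omega, a, ?_⟩
        rw [hab]; congr 1; omega
      · refine hmin (a - b) (by omega) ⟨by omega, b, ?_⟩
        rw [← hab]; congr 1; omega
    -- A closest repetition is at distance at least n, so the repeated wall is unchanged after one
    -- full period; thus g would fix a vertex.
    have := mk_eq_pathWall_of_eq hk hinj hi (e := n) (by omega)
    rw [hshift] at this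
    exact mk_ne_of_isLoxodromic hg _ _ this

namespace IsAxis

variable {g : RAAG Γ} {v : ℕ → V} {k : ℕ → ℤ} {n : ℕ}

theorem pathProd_mul (hA : IsAxis Γ g v k n) (m : ℕ) : pathProd Γ v k (m * n) = g ^ m := by
  induction m with
  | zero => simp [pathProd]
  | succ m ih =>
    rw [Nat.succ_mul, pathProd_add_period hA.periodic_type hA.periodic_exp hA.prod, ih, pow_succ]

open Classical in
theorem coord_pathProd (hA : IsAxis Γ g v k n) (N i : ℕ) :
    coord (pathProd Γ v k N) (pathWall Γ v k i) = if i < N then k i else 0 := by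
  split_ifs with hi
  · have := coord_pathProd_of_injOn (i := 0) (d := N) hA.injective.injOn
      (j := i) ⟨by omega, by omega⟩
    simpa [pathProd] using this
  · have := coord_pathProd_of_forall_ne (v := v) (k := k) (i := 0) (d := N)
      (x := pathWall Γ v k i) (fun l _ hl h => by have := hA.injective h; omega)
    simpa [pathProd] using this

theorem coord_pow (hA : IsAxis Γ g v k n) (m i : ℕ) :
    coord (g ^ m) (pathWall Γ v k i) = if i < m * n then k i else 0 := by
  rw [← hA.pathProd_mul, hA.coord_pathProd]

theorem exists_eq_pathWall (hA : IsAxis Γ g v k n) {m : ℕ} {x : ExtVertex Γ}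
    (hx : coord (g ^ m) x ≠ 0) : ∃ i < m * n, pathWall Γ v k i = x := by
  rw [← hA.pathProd_mul] at hx
  by_contra hc
  push Not at hc
  have := coord_pathProd_of_forall_ne (v := v) (k := k) (i := 0) (d := m * n)
      (x := x) (fun l _ hl => hc l (by omega))
  rw [zero_add] at this
  rw [this] at hx
  exact hx (coord_one x)

theorem coord_pow_eq_of_le (hA : IsAxis Γ g v k n) {m m' : ℕ} (hm : m ≤ m') {x : ExtVertex Γ}
    (hx : coord (g ^ m) x ≠ 0) : coord (g ^ m') x = coord (g ^ m) x := by
  obtain ⟨i, hi, rfl⟩ := hA.exists_eq_pathWall hx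
  rw [hA.coord_pow, hA.coord_pow, if_pos hi, if_pos (hi.trans_le (Nat.mul_le_mul_right n hm))]

theorem interval_mono (hA : IsAxis Γ g v k n) {m m' : ℕ} (hm : m ≤ m') :
    interval (g ^ m) ⊆ interval (g ^ m') := by
  intro h hh x
  rcases hh x with h0 | h0
  · exact Or.inl h0
  · by_cases hx : coord (g ^ m) x = 0
    · exact Or.inl (h0.trans hx)
    · exact Or.inr (h0.trans (hA.coord_pow_eq_of_le hm hx).symm)

theorem mul_pow_mem_interval (hA : IsAxis Γ g v k n) {m : ℕ} {h : RAAG Γ}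
    (hh : h ∈ interval (g ^ m)) (j : ℕ) : h * g ^ j ∈ interval (g ^ (m + j)) := by
  intro x
  have h1 := coord_mul h (g ^ j) x
  have h2 := coord_mul (g ^ m) (g ^ j) x
  rw [← pow_add] at h2
  by_cases hx : coord (g ^ j) x = 0
  · rcases hh (conj Γ (g ^ j)⁻¹ x) with h3 | h3 <;> omega
  · have h4 := hA.coord_pow_eq_of_le (Nat.le_add_left j m) hx
    rcases hh (conj Γ (g ^ j)⁻¹ x) with h3 | h3 <;> omega

/-- Commuting walls lie in a common chamber. Their types then commute, and equal types would make
the walls equal, against injectivity of the sequence. -/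
theorem not_commute_pathWall (hA : IsAxis Γ g v k n) {i j : ℕ} (hij : i ≠ j)
    (h : v i = v j ∨ ¬ Commute (gen Γ (v i)) (gen Γ (v j))) :
    ¬ Commute (pathWall Γ v k i).1 (pathWall Γ v k j).1 := by
  intro hc
  obtain ⟨u, w, p, hu, hw⟩ := exists_common_chamber hc
  have hu' := mk_inj_left hu
  have hw' := mk_inj_left hw
  rw [hu, hw, commute_mk_mk, ← hu', ← hw'] at hc
  rcases h with h | h
  · refine hij (hA.injective ?_)
    rw [hu, hw, ← hu', ← hw', h]
  · exact h hc

/-- The set of walls crossed by a point of an interval is closed downwards. -/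
theorem coord_ne_zero_of_lt (hA : IsAxis Γ g v k n) {m : ℕ} {h : RAAG Γ}
    (hh : h ∈ interval (g ^ m)) {i j : ℕ} (hij : i < j)
    (hc : v i = v j ∨ ¬ Commute (gen Γ (v i)) (gen Γ (v j)))
    (hj : coord h (pathWall Γ v k j) ≠ 0) : coord h (pathWall Γ v k i) ≠ 0 := by
  intro hi
  -- If wall j were crossed without wall i, the chambers 1, h, the partial product after step i and
  -- g^m would realise all four combinations of two levels, which nested walls forbid.
  obtain ⟨a, b, hab⟩ := exists_nested (hA.not_commute_pathWall hij.ne hc)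
  have hj' := (hh _).resolve_left hj
  have hjm : j < m * n := by
    by_contra hlt
    rw [hA.coord_pow, if_neg hlt] at hj'
    exact hj hj'
  have hi0 := hA.ne_zero i
  have h1 := hab 1
  have h2 := hab h
  have h3 := hab (pathProd Γ v k (i + 1))
  have h4 := hab (g ^ m)
  rw [hA.coord_pathProd, hA.coord_pathProd, if_pos (by omega), if_neg (by omega)] at h3
  rw [hA.coord_pow, hA.coord_pow, if_pos (by omega), if_pos hjm] at h4
  rw [hA.coord_pow, if_pos hjm] at hj'
  rw [coord_one, coord_one] at h1
  omega

theorem exists_index (hA : IsAxis Γ g v k n) (l c : ℕ) : ∃ j, c ≤ j ∧ j < c + n ∧ v j = v l := by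
  induction c with
  | zero =>
    exact ⟨l % n, by omega, by simpa using Nat.mod_lt l hA.pos,
      Function.Periodic.map_mod_nat hA.periodic_type l⟩
  | succ c ih =>
    obtain ⟨j, h1, h2, h3⟩ := ih
    by_cases hj : c + 1 ≤ j
    · exact ⟨j, hj, by omega, h3⟩
    · exact ⟨j + n, by have := hA.pos; omega, by omega, (hA.periodic_type j).trans h3⟩

/-- The types of the syllables of a loxodromic element do not split into two commuting families. -/
theorem not_split (hA : IsAxis Γ g v k n) (hg : IsLoxodromic (extAction Γ) g) (S : Set V)
    {a b : V} (ha : a ∈ S) (hb : b ∉ S) (hbv : b ∈ Set.range v)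
    (hS : ∀ i, v i ∉ S → ∀ u ∈ S, Commute (gen Γ u) (gen Γ (v i))) : False := by
  have hcent : ∀ i, v i ∉ S → gen Γ (v i) ∈ Subgroup.centralizer (gen Γ '' S) := by
    intro i hi
    rw [Subgroup.mem_centralizer_iff]
    rintro _ ⟨u, hu, rfl⟩
    exact (hS i hi u hu).eq
  have hcomm : ∀ p ∈ Subgroup.closure (gen Γ '' S), ∀ q ∈ Subgroup.centralizer (gen Γ '' S),
      Commute q p := by
    intro p hp q hq
    exact Subgroup.mem_centralizer_iff.mp (Subgroup.closure_le_centralizer_centralizer _ hp) q hq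
  have hsplit : ∀ N, ∃ p ∈ Subgroup.closure (gen Γ '' S),
      ∃ q ∈ Subgroup.centralizer (gen Γ '' S), pathProd Γ v k N = q * p := by
    intro N
    induction N with
    | zero => exact ⟨1, one_mem _, 1, one_mem _, by simp [pathProd]⟩
    | succ N ih =>
      obtain ⟨p, hp, q, hq, h⟩ := ih
      by_cases hN : v N ∈ S
      · have hv : gen Γ (v N) ^ k N ∈ Subgroup.closure (gen Γ '' S) :=
          Subgroup.zpow_mem _ (Subgroup.subset_closure (Set.mem_image_of_mem _ hN)) _
        refine ⟨_, mul_mem hv hp, q, hq, ?_⟩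
        rw [pathProd, h, ← mul_assoc, ← mul_assoc, (hcomm _ hv q hq).eq]
      · refine ⟨p, hp, _, mul_mem (zpow_mem (hcent N hN) (k N)) hq, ?_⟩
        rw [pathProd, h, mul_assoc]
  have hab : a ≠ b := by rintro rfl; exact hb ha
  obtain ⟨i, rfl⟩ := hbv
  have hgab := hS i hb a ha
  -- Write g^m = q * p with q centralizing S and p generated by S. Then a is moved to a^p, while the
  -- vertex outside S is fixed by p and adjacent to both a and a^p.
  have hdist : ∀ m : ℕ, (extensionGraph Γ).dist (ExtVertex.mk Γ a 1) (extAction Γ (op (g ^ m)) (ExtVertex.mk Γ a 1))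
      ≤ 2 := by
    intro m
    obtain ⟨p, hp, q, hq, h⟩ := hsplit (m * n)
    rw [hA.pathProd_mul] at h
    have h1 : extAction Γ (op (g ^ m)) (ExtVertex.mk Γ a 1) = ExtVertex.mk Γ a p := by
      refine (conj_mk (g ^ m) 1 a).trans ?_
      rw [one_mul, h, mk_mul_of_commute]
      exact hcomm _ (Subgroup.subset_closure ⟨a, ha, rfl⟩) q hq
    have h2 : ExtVertex.mk Γ (v i) p = ExtVertex.mk Γ (v i) 1 :=
      mk_eq_mk_one_iff.mpr (hcomm p hp _ (hcent i hb)).symm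
    have hadj : ∀ h, (extensionGraph Γ).Adj (ExtVertex.mk Γ a h) (ExtVertex.mk Γ (v i) h) := fun h =>
      ⟨fun H => hab (mk_inj_left H), commute_mk_mk.mpr hgab⟩
    rw [h1]
    exact SimpleGraph.dist_le (.cons (hadj 1) (.cons (h2 ▸ (hadj p).symm) .nil))
  obtain ⟨m, hm⟩ := (hg.eventually_lt_dist (ExtVertex.mk Γ a 1) 2).exists
  exact (hdist m).not_gt hm

/-- A gap of R periods guarantees a chain of pairwise successive non-commuting types from j back to
i; along it `coord_ne_zero_of_lt` applies repeatedly. -/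
theorem exists_closed_bound [Finite V] (hA : IsAxis Γ g v k n)
    (hg : IsLoxodromic (extAction Γ) g) :
    ∃ R : ℕ, ∀ m, ∀ h ∈ interval (g ^ m), ∀ i j, i + R * n ≤ j →
      coord h (pathWall Γ v k j) ≠ 0 → coord h (pathWall Γ v k i) ≠ 0 := by
  let Q : V → V → ℕ → Prop := fun a b R => ∀ m, ∀ h ∈ interval (g ^ m), ∀ i j,
    v i = a → v j = b → i + R * n ≤ j →
      coord h (pathWall Γ v k j) ≠ 0 → coord h (pathWall Γ v k i) ≠ 0
  have hQ : ∀ a b, ∃ R, a ∈ Set.range v → b ∈ Set.range v → Q a b R := by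
    intro a b
    by_cases ha : a ∈ Set.range v
    swap
    · exact ⟨0, fun h => absurd h ha⟩
    by_contra hcon
    push Not at hcon
    obtain ⟨-, hb, -⟩ := hcon 0
    -- The set collects the types c for which a crossed wall of type c forces all sufficiently
    -- earlier walls of type a to be crossed. A type in g not commuting with a member joins it at
    -- the cost of one more period.
    refine hA.not_split hg {c | c ∈ Set.range v ∧ ∃ R, Q a c R} (a := a) (b := b)
      ⟨ha, 0, ?_⟩ ?_ hb ?_
    · intro m h hh i j hi hj hij hne
      rcases (show i ≤ j by omega).eq_or_lt with rfl | hlt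
      · exact hne
      · exact hA.coord_ne_zero_of_lt hh hlt (Or.inl (hi.trans hj.symm)) hne
    · rintro ⟨-, R, hR⟩
      exact (hcon R).2.2 hR
    · rintro l hl _ ⟨⟨l', rfl⟩, R, hR⟩
      by_contra hc
      refine hl ⟨⟨l, rfl⟩, R + 1, ?_⟩
      intro m h hh i j hi hj hij hne
      rw [add_mul, one_mul] at hij
      obtain ⟨j', h1, h2, h3⟩ := hA.exists_index l' (j - n)
      refine hR m h hh i j' hi h3 (by omega) ?_
      refine hA.coord_ne_zero_of_lt hh (by omega) (Or.inr ?_) hne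
      rwa [h3, hj]
  choose R hR using hQ
  have := Fintype.ofFinite V
  refine ⟨Finset.univ.sup fun a => Finset.univ.sup (R a), fun m h hh i j hij hne => ?_⟩
  refine hR (v i) (v j) ⟨i, rfl⟩ ⟨j, rfl⟩ m h hh i j rfl rfl (le_trans ?_ hij) hne
  have h1 : R (v i) (v j) ≤ Finset.univ.sup (R (v i)) := Finset.le_sup (Finset.mem_univ _)
  have h2 : Finset.univ.sup (R (v i)) ≤ Finset.univ.sup fun a => Finset.univ.sup (R a) :=
    Finset.le_sup (f := fun a => Finset.univ.sup (R a)) (Finset.mem_univ _)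
  exact Nat.add_le_add_left (Nat.mul_le_mul_right n (h1.trans h2)) i

/-- Let j be the first period containing an uncrossed wall. All earlier periods are fully crossed,
so g^j can be split off; by `exists_closed_bound` nothing is crossed more than R periods beyond that
wall. The additional 1 accounts for its position within the period. -/
theorem exists_bound [Finite V] (hA : IsAxis Γ g v k n) (hg : IsLoxodromic (extAction Γ) g) :
    ∃ R : ℕ, ∀ m, ∀ h ∈ interval (g ^ m), ∃ j : ℕ, h * (g ^ j)⁻¹ ∈ interval (g ^ R) := by
  classical
  obtain ⟨R, hR⟩ := hA.exists_closed_bound hg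
  refine ⟨R + 1, fun m h hh => ?_⟩
  -- Period m works, since g^m crosses only the first m periods.
  have hex : ∃ c i, c * n ≤ i ∧ i < (c + 1) * n ∧ coord h (pathWall Γ v k i) = 0 := by
    refine ⟨m, m * n, le_rfl, by have := hA.pos; rw [add_mul]; omega, ?_⟩
    rcases hh (pathWall Γ v k (m * n)) with h0 | h0
    · exact h0
    · rw [h0, hA.coord_pow, if_neg (lt_irrefl _)]
  obtain ⟨i₀, h1, h2, h3⟩ := Nat.find_spec hex
  have hmin := fun c (hc : c < Nat.find hex) => Nat.find_min hex hc
  set j := Nat.find hex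
  refine ⟨j, fun x => ?_⟩
  have e1 := coord_mul (h * (g ^ j)⁻¹) (g ^ j) (conj Γ (g ^ j) x)
  have e2 := coord_mul (g ^ (R + 1)) (g ^ j) (conj Γ (g ^ j) x)
  rw [conj_conj, mul_inv_cancel, conj_one] at e1 e2
  rw [inv_mul_cancel_right] at e1
  rw [← pow_add] at e2
  generalize conj Γ (g ^ j) x = y at e1 e2
  by_cases hy : coord h y = 0
  · left
    by_cases hyj : coord (g ^ j) y = 0
    · omega
    · exfalso
      obtain ⟨i, hi, rfl⟩ := hA.exists_eq_pathWall hyj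
      refine hmin (i / n) ((Nat.div_lt_iff_lt_mul hA.pos).mpr hi)
        ⟨i, Nat.div_mul_le_self i n, ?_, hy⟩
      have := Nat.lt_div_mul_add (a := i) hA.pos
      rw [add_mul]; omega
  · right
    have hy' := (hh y).resolve_left hy
    obtain ⟨i, hi, rfl⟩ := hA.exists_eq_pathWall (m := m) (x := y) (hy' ▸ hy)
    have hi' : i < (R + 1 + j) * n := by
      by_contra hlt
      refine hR m h hh i₀ i ?_ hy h3
      simp only [add_mul, one_mul] at hlt h2 ⊢
      omega
    rw [hA.coord_pow, if_pos hi'] at e2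
    rw [hA.coord_pow, if_pos hi] at hy'
    omega

end IsAxis

end RAAG

end Axis

/-! ### Chambers of 𝒯_g and the axial subgraph properties. -/

section Main

variable {V : Type*} {Γ : SimpleGraph V}

namespace RAAG

open ExtVertex

/-- The chambers of the subgraph `axialT Γ g`. -/
def axialChambers (g : RAAG Γ) : Set (RAAG Γ) :=
  {h | ∃ m : ℕ, 1 ≤ m ∧ h * g ^ m ∈ interval (g ^ (2 * m))}

theorem image_mul_right_interval (g : RAAG Γ) (m : ℕ) :
    (· * (g ^ m)⁻¹) '' interval (g ^ (2 * m)) = {h | h * g ^ m ∈ interval (g ^ (2 * m))} := by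
  ext h
  constructor
  · rintro ⟨h, hh, rfl⟩
    simpa using hh
  · intro hh
    exact ⟨_, hh, by simp⟩

theorem axialT_eq (g : RAAG Γ) : axialT Γ g = chamberUnion Γ (axialChambers g) := by
  simp only [axialT, lambdaSubgraph_eq, translate_chamberUnion, image_mul_right_interval]
  refine le_antisymm (iSup₂_le fun m hm => chamberUnion_mono fun h hh => ⟨m, hm, hh⟩) ?_
  refine iSup₂_le fun h hh => ?_
  obtain ⟨m, hm, hh⟩ := hh
  exact le_iSup₂_of_le m hm (gammaTranslate_le_chamberUnion hh)

theorem chamberUnion_verts_finite [Finite V] {H : Set (RAAG Γ)} (hH : H.Finite) :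
    (chamberUnion Γ H).verts.Finite := by
  refine (hH.biUnion fun h _ => Set.finite_range fun v => mk Γ v h).subset ?_
  intro x hx
  obtain ⟨h, hh, hx⟩ := mem_chamberUnion.mp hx
  exact Set.mem_biUnion hh hx

variable {g : RAAG Γ} {v : ℕ → V} {k : ℕ → ℤ} {n : ℕ}

theorem IsAxis.mem_axialChambers_of_le (hA : IsAxis Γ g v k n) {h : RAAG Γ} {m M : ℕ}
    (hmM : m ≤ M) (hh : h * g ^ m ∈ interval (g ^ (2 * m))) :
    h * g ^ M ∈ interval (g ^ (2 * M)) := by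
  have := hA.mul_pow_mem_interval hh (M - m)
  rw [mul_assoc, ← pow_add, Nat.add_sub_cancel' hmM] at this
  exact hA.interval_mono (by omega) this

/-- This description by finitely many chambers up to powers of g is the source of invariance,
cocompactness and local finiteness. -/
theorem IsAxis.axialChambers_eq (hA : IsAxis Γ g v k n) {R : ℕ}
    (hR : ∀ m, ∀ h ∈ interval (g ^ m), ∃ j : ℕ, h * (g ^ j)⁻¹ ∈ interval (g ^ R)) :
    axialChambers g = {h | ∃ h₀ ∈ interval (g ^ R), ∃ j : ℤ, h = h₀ * g ^ j} := by
  ext h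
  constructor
  · rintro ⟨m, -, hh⟩
    obtain ⟨j, hj⟩ := hR _ _ hh
    refine ⟨_, hj, (j : ℤ) - m, ?_⟩
    rw [zpow_sub, zpow_natCast, zpow_natCast]
    group
  · rintro ⟨h₀, hh₀, j, rfl⟩
    -- This m satisfies m ≥ 1, j + m ≥ 0 and R + j + m ≤ 2m.
    refine ⟨R + j.natAbs + 1, by omega, ?_⟩
    have := hA.mul_pow_mem_interval hh₀ (j + (R + j.natAbs + 1 : ℕ)).toNat
    rw [← zpow_natCast g (Int.toNat _), Int.toNat_of_nonneg (by omega), zpow_add, zpow_natCast,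
      ← mul_assoc] at this
    exact hA.interval_mono (by omega) this

theorem isAxialSubgraph_axialT [Finite V] (hΓ : Γ.Connected)
    (hc : IsCyclicallySyllableReduced Γ g) (hg : IsLoxodromic (extAction Γ) g) :
    IsAxialSubgraph (extAction Γ) g (axialT Γ g) := by
  have := hΓ.nonempty
  obtain ⟨v, k, n, hA⟩ := exists_isAxis hc hg
  obtain ⟨R, hR⟩ := hA.exists_bound hg
  have hL := hA.axialChambers_eq hR
  rw [axialT_eq]
  refine ⟨?_, ?_, ?_, ?_, ?_⟩
  · refine ⟨mk Γ (v 0) 1, mem_chamberUnion.mpr ⟨1, ?_, v 0, rfl⟩⟩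
    rw [hL]
    exact ⟨1, one_mem_interval _, 0, by simp⟩
  · intro x hx y hy
    obtain ⟨h, ⟨m, hm, hh⟩, u, rfl⟩ := mem_chamberUnion.mp hx
    obtain ⟨h', ⟨m', hm', hh'⟩, u', rfl⟩ := mem_chamberUnion.mp hy
    -- The translated intervals increase with m, so both vertices lie in a single one, which is
    -- weakly convex.
    have key := (isWeaklyConvex_interval hΓ (g ^ (2 * max m m'))).translate
      (ρ := extAction Γ) (g ^ max m m')⁻¹
    rw [translate_chamberUnion, image_mul_right_interval] at key
    obtain ⟨p, hp, hpA⟩ := key (mk Γ u h)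
      (mem_chamberUnion.mpr ⟨h, hA.mem_axialChambers_of_le (le_max_left _ _) hh, u, rfl⟩)
      (mk Γ u' h')
      (mem_chamberUnion.mpr ⟨h', hA.mem_axialChambers_of_le (le_max_right _ _) hh', u', rfl⟩)
    exact ⟨p, hp, hpA.trans (chamberUnion_mono fun a ha =>
      ⟨max m m', hm.trans (le_max_left _ _), ha⟩)⟩
  · intro x _
    -- Only finitely many chambers of 𝒯_g contain x: for fixed h₀ and u, at most one power of g
    -- moves u^h₀ to x.
    have hfin : {h | h ∈ axialChambers g ∧ ∃ u, mk Γ u h = x}.Finite := by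
      have hsub : {h | h ∈ axialChambers g ∧ ∃ u, mk Γ u h = x} ⊆
          ⋃ h₀ ∈ interval (g ^ R), ⋃ u : V, (fun j : ℤ => h₀ * g ^ j) ''
            ((fun j : ℤ => extAction Γ (op (g ^ j)) (mk Γ u h₀)) ⁻¹' {x}) := by
        rintro h ⟨hh, u, hu⟩
        rw [hL] at hh
        obtain ⟨h₀, hh₀, j, rfl⟩ := hh
        simp only [Set.mem_iUnion]
        exact ⟨h₀, hh₀, u, j, (conj_mk _ _ _).trans hu, rfl⟩
      refine Set.Finite.subset ?_ hsub
      exact (interval_finite _).biUnion fun h₀ _ => Set.finite_iUnion fun u =>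
        ((Set.finite_singleton x).preimage (hg.act_zpow_injective _).injOn).image _
    refine (chamberUnion_verts_finite hfin).subset ?_
    intro y hy
    obtain ⟨h, hh, hx, hy, -⟩ := chamberUnion_adj.mp hy
    exact mem_chamberUnion.mpr ⟨h, ⟨hh, hx⟩, hy⟩
  · rw [translate_chamberUnion, hL]
    congr 1
    ext h
    constructor
    · rintro ⟨_, ⟨h₀, hh₀, j, rfl⟩, rfl⟩
      exact ⟨h₀, hh₀, j + 1, by rw [zpow_add_one, ← mul_assoc]⟩
    · rintro ⟨h₀, hh₀, j, rfl⟩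
      exact ⟨_, ⟨h₀, hh₀, j - 1, rfl⟩, by simp only [mul_assoc]; rw [← zpow_add_one, sub_add_cancel]⟩
  · refine ⟨chamberUnion Γ (interval (g ^ R)), chamberUnion_verts_finite (interval_finite _),
      chamberUnion_mono fun h hh => ?_, iSup₂_le fun h hh => ?_⟩
    · rw [hL]
      exact ⟨h, hh, 0, by simp⟩
    · rw [hL] at hh
      obtain ⟨h₀, hh₀, j, rfl⟩ := hh
      refine le_iSup_of_le j ?_
      rw [← translate_gammaTranslate]
      exact translateSubgraph_mono _ _ (gammaTranslate_le_chamberUnion hh₀)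

theorem exists_conj_isCyclicallySyllableReduced (g : RAAG Γ) :
    ∃ h, IsCyclicallySyllableReduced Γ (h⁻¹ * g * h) := by
  let f : RAAG Γ → ℕ := fun h => sylLength Γ (h⁻¹ * g * h)
  refine ⟨Function.argmin f, fun a => ?_⟩
  have := Function.argmin_le f (Function.argmin f * a)
  simpa only [f, mul_inv_rev, mul_assoc] using this

end RAAG

end Main

theorem mainTheorem3 {V : Type*} [Finite V] (Γ : SimpleGraph V) (hΓ : Γ.Connected) :
    HasFinitenessProperty (extAction Γ) ∧
      ∀ g : RAAG Γ, IsCyclicallySyllableReduced Γ g → IsLoxodromic (extAction Γ) g →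
        IsAxialSubgraph (extAction Γ) g (axialT Γ g) ∧
          ∃ κ : ℕ, graphWidth (axialT Γ g).coe ≤ κ := by
  refine ⟨fun g hg => ?_, fun g hc hg => ?_⟩
  · obtain ⟨h, hh⟩ := RAAG.exists_conj_isCyclicallySyllableReduced g
    have := (RAAG.isAxialSubgraph_axialT hΓ hh (hg.conj h)).translate h⁻¹
    rw [show h⁻¹⁻¹ * (h⁻¹ * g * h) * h⁻¹ = g by group] at this
    exact ⟨_, this⟩
  · have hA := RAAG.isAxialSubgraph_axialT hΓ hc hg
    exact ⟨hA, hA.exists_graphWidth_le hg⟩
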